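/- Let $\kappa$ be a finite field with $q$ elements, of odd characteristic, and let $\widehat{\kappa^*}=\mathrm{Hom}(\kappa^*,\mathbb{C}^*)$ be its group of multiplicative characters, with trivial character $\varepsilon$ and quadratic character $\phi$; every $\chi\in\widehat{\kappa^*}$ is extended to $\kappa$ by $\chi(0)=0$. Let $\delta$ denote the characteristic function of the identity element, both on the additive group $\kappa$ and on $\widehat{\kappa^*}$. Fix a non-trivial additive character $\psi$ of $\kappa$ and put, for $\chi,\nu\in\widehat{\kappa^*}$, $$g(\chi)=-\sum_{x\in\kappa}\psi(x)\chi(x),\quad g^\circ(\chi)=q^{\delta(\chi)}g(\chi),\quad (\chi)_\nu=\frac{g(\chi\nu)}{g(\chi)},\quad (\chi)^\circ_\nu=\frac{g^\circ(\chi\nu)}{g^\circ(\chi)}.$$ For $\alpha_1,\dots,\alpha_r,\beta_1,\dots,\beta_s\in\widehat{\kappa^*}$ and $\lambda\in\kappa$ define $$F\left({\alpha_1,\dots,\alpha_r\atop \beta_1,\dots,\beta_s};\lambda\right)=\frac{1}{1-q}\sum_{\nu\in\widehat{\kappa^*}}\frac{\prod_{i=1}^r(\alpha_i)_\nu}{(\varepsilon)^\circ_\nu\prod_{j=1}^s(\beta_j)^\circ_\nu}\,\nu(\lambda).$$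 Let $\alpha,\beta\in\widehat{\kappa^*}$ be such that $\alpha^2\ne\varepsilon$, $\beta^2\ne\varepsilon$, $\alpha\beta\ne\varepsilon$ and $\alpha\ne\beta\phi$. Then for any $\lambda\in\kappa^*$, $$F\left({\alpha,\beta\atop\alpha\beta\phi};\lambda\right)^2+\delta(1-\lambda)\left(\frac{g^\circ(\alpha\beta\phi)g(\phi)}{g(\alpha)g(\beta)}\right)^2 =F\left({\alpha^2,\beta^2,\alpha\beta\atop\alpha^2\beta^2,\alpha\beta\phi};\lambda\right)+q\,\frac{g^\circ(\alpha\beta\phi)}{g(\alpha)g(\beta)}\,\frac{g^\circ(\alpha\beta\phi)}{g(\alpha\phi)g(\beta\phi)}\,\alpha\beta(\lambda^{-1})\,\phi(1-\lambda^{-1}).$$ In particular, $$F\left({\alpha^2,\beta^2,\alpha\beta\atop\alpha^2\beta^2,\alpha\beta\phi};1\right)=\left(\frac{g^\circ(\alpha\beta\phi)g(\phi)}{g(\alpha)g(\beta)}\right)^2+\left(\frac{g^\circ(\alpha\beta\phi)g(\phi)}{g(\alpha\phi)g(\beta\phi)}\right)^2$$ and $$F\left({\alpha,\beta\atop\alpha\beta\phi};\lambda\right)^2=F\left({\alpha\phi,\beta\phi\atop\alpha\beta\phi};\lambda\right)^2\qquad(\lambda\in\kappa,\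 \lambda\ne1).$$ -/

import Mathlib

namespace FiniteHypergeometric

noncomputable section

open scoped Classical

variable {K : Type*} [Field K] [Fintype K]

/-- The finite set of multiplicative characters of a finite field. A term of `MulChar K ℂ` is a
homomorphism `Kˣ → ℂˣ` extended by `χ 0 = 0`; the trivial character is `1`. -/
instance instFintypeMulChar : Fintype (MulChar K ℂ) := Fintype.ofFinite _

/-- The characteristic function of the identity element on the additive group of `K`. -/
def deltaAdd (x : K) : ℕ := if x = 0 then 1 else 0

/-- The characteristic function of the identity element on the group of multiplicative
characters. -/
def deltaChar (χ : MulChar K ℂ) : ℕ := if χ = 1 then 1 else 0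

variable (K) in
/-- The quadratic character of `K`, with complex values. -/
def quadChar : MulChar K ℂ := (quadraticChar K).ringHomComp (Int.castRingHom ℂ)

/-- The Gauss sum, with the sign normalization `g(1) = 1`. -/
def g (ψ : AddChar K ℂ) (χ : MulChar K ℂ) : ℂ := -∑ x : K, ψ x * χ x

/-- The modified Gauss sum `q ^ δ(χ) * g(χ)`. -/
def gCirc (ψ : AddChar K ℂ) (χ : MulChar K ℂ) : ℂ :=
  (Fintype.card K : ℂ) ^ deltaChar χ * g ψ χ

/-- The Pochhammer symbol `(α)_ν` of a character. -/
def poch (ψ : AddChar K ℂ) (α ν : MulChar K ℂ) : ℂ := g ψ (α * ν) / g ψ α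

/-- The modified Pochhammer symbol `(α)°_ν` of a character. -/
def pochCirc (ψ : AddChar K ℂ) (α ν : MulChar K ℂ) : ℂ := gCirc ψ (α * ν) / gCirc ψ α

variable (K) in
/-- The free abelian monoid of parameters: finite formal sums of characters. -/
abbrev Param : Type _ := Multiset (MulChar K ℂ)

/-- The symmetric biadditive pairing on parameters with `(α, χ) = δ(α χ⁻¹)` on characters. -/
def pairing (A B : Param K) : ℕ := (A.map fun α => (B.map fun χ => deltaChar (α * χ⁻¹)).sum).sum

/-- The Pochhammer symbol of a parameter. -/
def pochParam (ψ : AddChar K ℂ) (A : Param K) (ν : MulChar K ℂ) : ℂ :=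
  (A.map fun α => poch ψ α ν).prod

/-- The modified Pochhammer symbol of a parameter. -/
def pochCircParam (ψ : AddChar K ℂ) (A : Param K) (ν : MulChar K ℂ) : ℂ :=
  (A.map fun α => pochCirc ψ α ν).prod

/-- The hypergeometric function `F(A, B; x)` over the finite field `K`. -/
def hyp (ψ : AddChar K ℂ) (A B : Param K) (x : K) : ℂ :=
  1 / (1 - (Fintype.card K : ℂ)) *
    ∑ ν : MulChar K ℂ, pochParam ψ A ν / pochCircParam ψ B ν * ν x

/-- The function `F(α₁, …, αᵣ ; β₁, …, βₛ ; x)` in the classical notation, in which the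
denominator parameter `1` is left implicit. -/
def hypF (ψ : AddChar K ℂ) (A B : Param K) (x : K) : ℂ := hyp ψ A ({1} + B) x

end

end FiniteHypergeometric

open FiniteHypergeometric

namespace FiniteHypergeometric

noncomputable section

open scoped Classical
open Finset

set_option linter.unusedSectionVars false

variable {K : Type*} [Field K] [Fintype K]

/-! ### Gauss and Jacobi sums -/

/-! Write φ for the quadratic character and q for the order of the field. Mellin inversion turns
both hypergeometric functions into explicit character sums: for x ≠ 0, the ₂F₁ is a constant times
`eulerSum α β x` (`hypF_two_one_eq`), and the ₃F₂ is a constant times `cubicSum α β x`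
(`hypF_three_two_eq`). The constants match through reflection and duplication of Gauss sums.

The ₂F₁ is symmetric in α and β but its Euler-type sum is not, so its square is a multiple of
`eulerSum α β x * eulerSum β α x`. For x ≠ 1, Euler's transformation of the second factor makes the
product a double sum over (t, u) in which α is evaluated at a = (1-t)(1-u)/((1-xt)(1-xu)) and β at b
= tu, with a quadratic character as weight. The cubic sum has the same shape, its fibre over (a, b)
being the square roots m of ab. Clausen's formula thus reduces to comparing quadratic character sums
fibre by fibre.

Over generic (a, b) the fibres agree (`fiberSum_eq_sqrtSum`): t and u are the roots of a quadratic
whose discriminant, up to a square, is f(m)f(-m), with f(m) the value of `fiberForm` at m. They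
differ only where xa = 1 or xb = 1. There the point a = b = x⁻¹ yields the extra term
q·αβ(x⁻¹)φ(1-x⁻¹), and the remaining discrepancies sum to zero because α² and β² are non-trivial
(`eulerSum_mul_eulerSum_eq`).

At x = 1 both sides are evaluated by Jacobi sums. The last identity holds because the right-hand
side is unchanged under (α, β) ↦ (αφ, βφ). -/

lemma g_eq_neg_gaussSum (ψ : AddChar K ℂ) (χ : MulChar K ℂ) : g ψ χ = -gaussSum χ ψ := by
  simp only [g, gaussSum, mul_comm]

lemma g_one {ψ : AddChar K ℂ} (hψ : ψ ≠ 1) : g ψ 1 = 1 := by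
  rw [g_eq_neg_gaussSum, gaussSum_one_left hψ, neg_neg]

lemma card_cast_ne_zero : (Fintype.card K : ℂ) ≠ 0 := by
  exact_mod_cast Fintype.card_ne_zero

lemma gCirc_one {ψ : AddChar K ℂ} (hψ : ψ ≠ 1) : gCirc ψ 1 = Fintype.card K := by
  simp [gCirc, deltaChar, g_one hψ]

lemma gCirc_of_ne_one (ψ : AddChar K ℂ) {χ : MulChar K ℂ} (h : χ ≠ 1) : gCirc ψ χ = g ψ χ := by
  simp [gCirc, deltaChar, h]

lemma mulChar_neg_one_sq (χ : MulChar K ℂ) : χ (-1) * χ (-1) = 1 := by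
  rw [← map_mul]; simp

/-- The reflection formula. The extra factor q in `gCirc` at the trivial character is what makes it
uniform in χ. -/
lemma gCirc_mul_g_inv {ψ : AddChar K ℂ} (hψ : ψ ≠ 1) (χ : MulChar K ℂ) :
    gCirc ψ χ * g ψ χ⁻¹ = χ (-1) * Fintype.card K := by
  by_cases h : χ = 1
  · subst h
    rw [gCirc_one hψ, inv_one, g_one hψ, MulChar.one_apply (by simp)]
    ring
  · have h2 := gaussSum_mul_gaussSum_eq_card h (AddChar.IsPrimitive.of_ne_one hψ)
    rw [gCirc_of_ne_one ψ h, g_eq_neg_gaussSum, g_eq_neg_gaussSum,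
      ← mul_gaussSum_inv_eq_gaussSum χ⁻¹, MulChar.inv_apply', inv_neg_one, ← h2]
    ring

lemma mulChar_neg_one_ne_zero (χ : MulChar K ℂ) : χ (-1) ≠ 0 := by
  intro h
  have := mulChar_neg_one_sq χ
  simp [h] at this

lemma g_ne_zero {ψ : AddChar K ℂ} (hψ : ψ ≠ 1) (χ : MulChar K ℂ) : g ψ χ ≠ 0 := by
  have h := gCirc_mul_g_inv hψ χ⁻¹
  rw [inv_inv] at h
  intro h0
  rw [h0, mul_zero] at h
  exact mul_ne_zero (mulChar_neg_one_ne_zero χ⁻¹) card_cast_ne_zero h.symm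

lemma gCirc_ne_zero {ψ : AddChar K ℂ} (hψ : ψ ≠ 1) (χ : MulChar K ℂ) : gCirc ψ χ ≠ 0 :=
  mul_ne_zero (pow_ne_zero _ card_cast_ne_zero) (g_ne_zero hψ χ)

/-- The reflection formula solved for the Gauss sum of the inverse character. -/
lemma g_inv {ψ : AddChar K ℂ} (hψ : ψ ≠ 1) (χ : MulChar K ℂ) :
    g ψ χ⁻¹ = χ (-1) * Fintype.card K / gCirc ψ χ := by
  rw [eq_div_iff (gCirc_ne_zero hψ χ), mul_comm, gCirc_mul_g_inv hψ]

lemma gCirc_inv {ψ : AddChar K ℂ} (hψ : ψ ≠ 1) (χ : MulChar K ℂ) :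
    gCirc ψ χ⁻¹ = χ (-1) * Fintype.card K / g ψ χ := by
  rw [eq_div_iff (g_ne_zero hψ χ)]
  have h := gCirc_mul_g_inv hψ χ⁻¹
  rwa [inv_inv, MulChar.inv_apply', inv_neg_one] at h

/-- With `gCirc` in the denominator the case χη = 1 needs no separate formula; only the pair (1, 1),
whose Jacobi sum is q - 2, escapes. -/
lemma jacobiSum_eq_g {ψ : AddChar K ℂ} (hψ : ψ ≠ 1) (χ η : MulChar K ℂ) (h : χ ≠ 1 ∨ η ≠ 1) :
    jacobiSum χ η = -(g ψ χ * g ψ η) / gCirc ψ (χ * η) := by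
  rw [eq_div_iff (gCirc_ne_zero hψ _)]
  by_cases h1 : χ * η = 1
  · have hη : η = χ⁻¹ := eq_inv_of_mul_eq_one_right h1
    have hχ : χ ≠ 1 := by
      rintro rfl
      simp [hη] at h
    rw [h1, gCirc_one hψ, hη, jacobiSum_nontrivial_inv hχ, ← gCirc_of_ne_one ψ hχ,
      gCirc_mul_g_inv hψ]
    ring
  · rw [gCirc_of_ne_one ψ h1]
    simp only [g_eq_neg_gaussSum]
    linear_combination -(jacobiSum_mul_nontrivial h1 ψ)

/-! ### The quadratic character -/

lemma quadChar_apply (x : K) : quadChar K x = (quadraticChar K x : ℂ) := by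
  simp [quadChar]

lemma quadChar_mul_self : quadChar K * quadChar K = 1 := by
  rw [← sq]
  exact ((quadraticChar_isQuadratic K).comp _).sq_eq_one

lemma quadChar_inv : (quadChar K)⁻¹ = quadChar K :=
  inv_eq_of_mul_eq_one_left quadChar_mul_self

lemma mul_quadChar_mul_quadChar (χ : MulChar K ℂ) : χ * quadChar K * quadChar K = χ := by
  rw [mul_assoc, quadChar_mul_self, mul_one]

lemma mul_quadChar_ne_one {χ : MulChar K ℂ} (h : χ ^ 2 ≠ 1) : χ * quadChar K ≠ 1 := by
  intro h1
  rw [← eq_inv_iff_mul_eq_one, quadChar_inv] at h1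
  exact h (by rw [h1, sq, quadChar_mul_self])

lemma quadChar_ne_one (hK : ringChar K ≠ 2) : quadChar K ≠ 1 := by
  rw [quadChar, MulChar.ringHomComp_ne_one_iff (RingHom.injective_int _)]
  exact quadraticChar_ne_one hK

lemma quadChar_sq {x : K} (hx : x ≠ 0) : quadChar K x * quadChar K x = 1 := by
  rw [← MulChar.mul_apply, quadChar_mul_self, MulChar.one_apply hx.isUnit]

lemma quadChar_sq_mul {x : K} (hx : x ≠ 0) (y : K) : quadChar K (x ^ 2 * y) = quadChar K y := by
  rw [map_mul, sq, map_mul, quadChar_sq hx, one_mul]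

lemma quadChar_pow_two {x : K} (hx : x ≠ 0) : quadChar K (x ^ 2) = 1 := by
  rw [sq, map_mul, quadChar_sq hx]

lemma quadChar_eq_of_mul_eq_sq {x y z : K} (hz : z ≠ 0) (h : x * y = z ^ 2) :
    quadChar K x = quadChar K y := by
  have hxy : quadChar K x * quadChar K y = 1 := by rw [← map_mul, h, quadChar_pow_two hz]
  have hy : y ≠ 0 := by
    rintro rfl
    exact pow_ne_zero 2 hz (by rw [← h, mul_zero])
  linear_combination quadChar K y * hxy - quadChar K x * quadChar_sq hy

lemma quadChar_inv_apply (x : K) : quadChar K x⁻¹ = quadChar K x := by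
  rw [← MulChar.inv_apply', quadChar_inv]

lemma quadChar_of_not_isSquare {x : K} (hx : ¬IsSquare x) : quadChar K x = -1 := by
  rw [quadChar_apply, quadraticChar_neg_one_iff_not_isSquare.2 hx]
  simp

lemma sum_sqrts (hK : ringChar K ≠ 2) (a : K) :
    ∑ m : K, (if m ^ 2 = a then (1 : ℂ) else 0) = 1 + quadChar K a := by
  have h := quadraticChar_card_sqrts hK a
  rw [quadChar_apply, Finset.sum_boole, add_comm]
  rw [show (Finset.univ.filter fun m : K => m ^ 2 = a) = {x : K | x ^ 2 = a}.toFinset by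
    ext; simp]
  exact_mod_cast h

/-- The number of roots of a monic quadratic polynomial. -/
lemma sum_quadratic_roots (hK : ringChar K ≠ 2) (s b : K) :
    ∑ t : K, (if t ^ 2 - s * t + b = 0 then (1 : ℂ) else 0) = 1 + quadChar K (s ^ 2 - 4 * b) := by
  have h2 : (2 : K) ≠ 0 := Ring.two_ne_zero hK
  rw [← sum_sqrts hK]
  refine Fintype.sum_equiv ((Equiv.mulLeft₀ 2 h2).trans (Equiv.subRight s)) _ _ fun t => ?_
  refine if_congr ?_ rfl rfl
  have : (((Equiv.mulLeft₀ 2 h2).trans (Equiv.subRight s)) t) = 2 * t - s := rfl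
  rw [this]
  constructor
  · intro h
    linear_combination 4 * h
  · intro h
    have : (2 : K) ^ 2 * (t ^ 2 - s * t + b) = 0 := by linear_combination h
    exact (mul_eq_zero.1 this).resolve_left (pow_ne_zero _ h2)

lemma four_ne_zero_of_ringChar (hK : ringChar K ≠ 2) : (4 : K) ≠ 0 := by
  have h2 : (2 : K) ≠ 0 := Ring.two_ne_zero hK
  have : (4 : K) = 2 ^ 2 := by norm_num
  rw [this]; exact pow_ne_zero _ h2

/-- Group the terms by u = x(1-x), which has 1 + φ(1-4u) preimages, then rescale u by 4. -/
lemma jacobiSum_self (hK : ringChar K ≠ 2) {χ : MulChar K ℂ} (hχ : χ ≠ 1) :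
    jacobiSum χ χ = χ⁻¹ 4 * jacobiSum χ (quadChar K) := by
  have h4 := four_ne_zero_of_ringChar hK
  have h : jacobiSum χ χ = ∑ u : K, χ u * (1 + quadChar K (1 - 4 * u)) := by
    have e (u : K) : χ u * (1 + quadChar K (1 - 4 * u)) =
        ∑ x : K, if x * (1 - x) = u then χ (x * (1 - x)) else 0 := by
      have := sum_quadratic_roots hK 1 u
      rw [one_pow] at this
      rw [← this, mul_sum]
      refine sum_congr rfl fun x _ => ?_
      have : x ^ 2 - 1 * x + u = 0 ↔ x * (1 - x) = u := by
        constructor <;> intro h <;> linear_combination -h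
      rw [this]
      split_ifs with h
      · rw [h, mul_one]
      · rw [mul_zero]
    simp_rw [e]
    rw [sum_comm]
    simp [jacobiSum]
  rw [h]
  simp only [mul_add, mul_one, sum_add_distrib, MulChar.sum_eq_zero_of_ne_one hχ, zero_add,
    jacobiSum, mul_sum]
  refine Fintype.sum_equiv (Equiv.mulLeft₀ 4 h4) _ _ fun u => ?_
  have : Equiv.mulLeft₀ 4 h4 u = 4 * u := rfl
  rw [this, MulChar.inv_apply', ← mul_assoc, ← map_mul, inv_mul_cancel_left₀ h4]

/-- The duplication formula for Gauss sums. -/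
lemma g_mul_gCirc_quadChar (hK : ringChar K ≠ 2) {ψ : AddChar K ℂ} (hψ : ψ ≠ 1)
    {χ : MulChar K ℂ} (hχ : χ ≠ 1) :
    g ψ χ * gCirc ψ (χ * quadChar K) = χ⁻¹ 4 * g ψ (quadChar K) * gCirc ψ (χ ^ 2) := by
  have h := jacobiSum_self hK hχ
  rw [jacobiSum_eq_g hψ _ _ (Or.inl hχ), jacobiSum_eq_g hψ _ _ (Or.inl hχ)] at h
  have h1 := g_ne_zero hψ χ
  have h2 := gCirc_ne_zero hψ (χ * quadChar K)
  have h3 := gCirc_ne_zero hψ (χ ^ 2)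
  rw [sq] at h3
  rw [sq χ]
  field_simp at h
  linear_combination -h

/-! ### Mellin inversion -/

lemma sum_mulChar_apply (x : K) :
    ∑ ν : MulChar K ℂ, ν x = if x = 1 then (Fintype.card K : ℂ) - 1 else 0 := by
  split_ifs with h
  · subst h
    have h1 := MulChar.card_eq_card_units_of_hasEnoughRootsOfUnity K ℂ
    rw [Nat.card_eq_fintype_card, Nat.card_eq_fintype_card, Fintype.card_units] at h1
    simp only [map_one, sum_const, nsmul_eq_mul, mul_one, card_univ, h1]
    rw [Nat.cast_sub Fintype.card_pos, Nat.cast_one]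
  · obtain ⟨χ, hχ⟩ := MulChar.exists_apply_ne_one_of_hasEnoughRootsOfUnity K ℂ h
    have h2 : χ x * ∑ ν : MulChar K ℂ, ν x = ∑ ν : MulChar K ℂ, ν x := by
      rw [mul_sum]
      exact Fintype.sum_equiv (Equiv.mulLeft χ) _ _ fun ν => by simp
    have h3 : (χ x - 1) * ∑ ν : MulChar K ℂ, ν x = 0 := by linear_combination h2
    exact (mul_eq_zero.1 h3).resolve_left (sub_ne_zero.2 hχ)

/-- The Mellin transform of a function on the nonzero elements of a finite field. -/
def mellin (f : K → ℂ) (ν : MulChar K ℂ) : ℂ := ∑ y : K, ν⁻¹ y * f y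

lemma sum_mellin (f : K → ℂ) {x : K} (hx : x ≠ 0) :
    ∑ ν : MulChar K ℂ, mellin f ν * ν x = ((Fintype.card K : ℂ) - 1) * f x := by
  simp only [mellin, sum_mul]
  rw [sum_comm]
  have e (y : K) : ∑ ν : MulChar K ℂ, ν⁻¹ y * f y * ν x =
      if x = y then ((Fintype.card K : ℂ) - 1) * f x else 0 := by
    have : ∀ ν : MulChar K ℂ, ν⁻¹ y * f y * ν x = ν (y⁻¹ * x) * f y := fun ν => by
      rw [MulChar.inv_apply', map_mul]; ring
    simp only [this, ← sum_mul, sum_mulChar_apply]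
    by_cases hy : y = 0
    · subst hy; simp [hx]
    · have : y⁻¹ * x = 1 ↔ x = y := by rw [inv_mul_eq_one₀ hy, eq_comm]
      simp only [this]
      split_ifs with h
      · rw [h]
      · simp
  simp [e]

lemma one_sub_card_ne_zero : 1 - (Fintype.card K : ℂ) ≠ 0 := by
  have : 1 < Fintype.card K := Fintype.one_lt_card
  rw [sub_ne_zero]
  exact_mod_cast this.ne

/-- A hypergeometric function whose coefficients are proportional to a Mellin transform. -/
lemma hyp_eq_of_mellin (ψ : AddChar K ℂ) (A B : Param K) (f : K → ℂ) (c : ℂ)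
    (h : ∀ ν, pochParam ψ A ν / pochCircParam ψ B ν = -c * mellin f ν) {x : K} (hx : x ≠ 0) :
    hyp ψ A B x = c * f x := by
  have e : ∀ ν : MulChar K ℂ, -c * mellin f ν * ν x = -c * (mellin f ν * ν x) := fun ν => by ring
  simp only [hyp, h, e]
  rw [← mul_sum, sum_mellin f hx]
  have := one_sub_card_ne_zero (K := K)
  field_simp
  ring

/-! ### The Euler-type character sum for `F(α, β; αβφ; x)` -/

lemma sum_mulChar_mul_comp (χ : MulChar K ℂ) (f : K → ℂ) {t : K} (ht : t ≠ 0) :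
    ∑ y : K, χ y * f (y * t) = χ⁻¹ t * ∑ y : K, χ y * f y := by
  rw [mul_sum]
  refine Fintype.sum_equiv (Equiv.mulRight₀ t ht) _ _ fun y => ?_
  have : Equiv.mulRight₀ t ht y = y * t := rfl
  rw [this, MulChar.inv_apply', ← mul_assoc, ← map_mul, mul_comm y t, inv_mul_cancel_left₀ ht]

/-- The character sum representing `F(α, β; αβφ; x)`. -/
def eulerSum (α β : MulChar K ℂ) (x : K) : ℂ :=
  ∑ t : K, β t * (α * quadChar K) (1 - t) * α⁻¹ (1 - x * t)

/-- Replacing y by y/t for fixed t ≠ 0 separates the two variables. -/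
lemma mellin_eulerSum (α β ν : MulChar K ℂ) :
    mellin (eulerSum α β) ν = jacobiSum (β * ν) (α * quadChar K) * jacobiSum ν⁻¹ α⁻¹ := by
  simp only [mellin, eulerSum, mul_sum]
  rw [sum_comm]
  simp only [jacobiSum, sum_mul]
  refine sum_congr rfl fun t _ => ?_
  by_cases ht : t = 0
  · simp [ht, MulChar.map_zero]
  · have h := sum_mulChar_mul_comp ν⁻¹ (fun y => α⁻¹ (1 - y)) ht
    rw [inv_inv] at h
    calc ∑ y : K, ν⁻¹ y * (β t * (α * quadChar K) (1 - t) * α⁻¹ (1 - y * t))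
        = β t * (α * quadChar K) (1 - t) * ∑ y : K, ν⁻¹ y * α⁻¹ (1 - y * t) := by
          rw [mul_sum]; exact sum_congr rfl fun y _ => by ring
      _ = _ := by rw [h, MulChar.mul_apply β]; ring

lemma mellin_eulerSum_eq_g {ψ : AddChar K ℂ} (hψ : ψ ≠ 1)
    {α : MulChar K ℂ} (hα : α ^ 2 ≠ 1) (β ν : MulChar K ℂ) :
    mellin (eulerSum α β) ν = Fintype.card K * g ψ (α * quadChar K) * g ψ (α * ν) * g ψ (β * ν) /
      (g ψ α * gCirc ψ ν * gCirc ψ (α * β * quadChar K * ν)) := by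
  have hα1 : α ≠ 1 := by rintro rfl; simp at hα
  have hαφ := mul_quadChar_ne_one hα
  rw [mellin_eulerSum, jacobiSum_eq_g hψ _ _ (Or.inr hαφ),
    jacobiSum_eq_g hψ _ _ (Or.inr (inv_ne_one.2 hα1)), ← mul_inv, gCirc_inv hψ, g_inv hψ, g_inv hψ,
    gCirc_of_ne_one ψ hα1, show β * ν * (α * quadChar K) = α * β * quadChar K * ν by
      ac_rfl, MulChar.mul_apply, mul_comm ν α]
  have h1 := g_ne_zero hψ α
  have h2 := gCirc_ne_zero hψ ν
  have h3 := gCirc_ne_zero hψ (α * β * quadChar K * ν)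
  have h4 := g_ne_zero hψ (α * ν)
  have h5 := card_cast_ne_zero (K := K)
  have h6 := mulChar_neg_one_ne_zero α
  have h7 := mulChar_neg_one_ne_zero ν
  field_simp

lemma hypF_two_one_eq {ψ : AddChar K ℂ} (hψ : ψ ≠ 1)
    {α : MulChar K ℂ} (hα : α ^ 2 ≠ 1) (β : MulChar K ℂ) {x : K} (hx : x ≠ 0) :
    hypF ψ {α, β} {α * β * quadChar K} x =
      -(gCirc ψ (α * β * quadChar K) / (g ψ β * g ψ (α * quadChar K))) * eulerSum α β x := by
  refine hyp_eq_of_mellin ψ _ _ _ _ (fun ν => ?_) hx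
  rw [mellin_eulerSum_eq_g hψ hα]
  have h1 := g_ne_zero hψ α
  have h2 := gCirc_ne_zero hψ ν
  have h3 := gCirc_ne_zero hψ (α * β * quadChar K * ν)
  have h4 := g_ne_zero hψ β
  have h5 := g_ne_zero hψ (α * quadChar K)
  have h6 := gCirc_ne_zero hψ (α * β * quadChar K)
  have h7 := card_cast_ne_zero (K := K)
  simp only [pochParam, pochCircParam, Multiset.insert_eq_cons, Multiset.map_cons,
    Multiset.map_singleton, Multiset.prod_cons, Multiset.prod_singleton, Multiset.map_add,
    Multiset.prod_add, poch, pochCirc, gCirc_one hψ, one_mul]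
  field_simp

/-! ### Characters of order two -/

/-- Such a χ is 1 on nonzero squares and constant on non-squares, since the product of two
non-squares is a square. -/
lemma eq_one_or_eq_quadChar (hK : ringChar K ≠ 2) {χ : MulChar K ℂ} (h : χ ^ 2 = 1) :
    χ = 1 ∨ χ = quadChar K := by
  obtain ⟨u, hu⟩ := quadraticChar_exists_neg_one' hK
  have hu0 : (u : K) ≠ 0 := u.ne_zero
  have hφu : quadChar K u = -1 := by rw [quadChar_apply, hu]; simp
  have hsq (a : K) (ha : a ≠ 0) : χ a * χ a = 1 := by
    rw [← MulChar.mul_apply, ← sq, h, MulChar.one_apply ha.isUnit]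
  have hsquare (a : K) (ha : a ≠ 0) (h1 : IsSquare a) : χ a = 1 := by
    obtain ⟨r, rfl⟩ := h1
    rw [map_mul]
    exact hsq r (by rintro rfl; simp at ha)
  have hnon (a : K) (ha : a ≠ 0) (h1 : ¬IsSquare a) : χ a = χ u := by
    have h2 : IsSquare (a * u) := by
      rw [← quadraticChar_one_iff_isSquare (mul_ne_zero ha hu0), map_mul, hu,
        quadraticChar_neg_one_iff_not_isSquare.2 h1]
      norm_num
    have h3 := hsquare _ (mul_ne_zero ha hu0) h2
    rw [map_mul] at h3
    linear_combination χ u * h3 - χ a * hsq u hu0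
  rcases mul_self_eq_one_iff.1 (hsq u hu0) with h1 | h1
  · left
    refine MulChar.ext fun a => ?_
    rw [MulChar.one_apply_coe]
    by_cases ha : IsSquare (a : K)
    · exact hsquare _ a.ne_zero ha
    · rw [hnon _ a.ne_zero ha, h1]
  · right
    refine MulChar.ext fun a => ?_
    by_cases ha : IsSquare (a : K)
    · rw [hsquare _ a.ne_zero ha, quadChar_apply,
        (quadraticChar_one_iff_isSquare a.ne_zero).2 ha]
      simp
    · rw [hnon _ a.ne_zero ha, h1, quadChar_of_not_isSquare ha]

lemma sum_one_mulChar : ∑ x : K, (1 : MulChar K ℂ) x = Fintype.card K - 1 := by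
  rw [MulChar.sum_one_eq_card_units, Fintype.card_units, Nat.cast_sub Fintype.card_pos,
    Nat.cast_one]

/-! ### The character sum for the product of two Euler-type sums -/

/-- The form whose quadratic character enters `cubicSum`. -/
def fiberForm (x m a b : K) : K := (1 - x * m) ^ 2 + 2 * m - a - b

/-- The character sum representing `F(α², β², αβ; α²β², αβφ; x)`. -/
def cubicSum (α β : MulChar K ℂ) (x : K) : ℂ :=
  ∑ m : K, ∑ a : K, (α * β) m * (α * β⁻¹) a * quadChar K (fiberForm x m (m * a) (m * a⁻¹))

/-- The argument of φ is (1-n)² - m(1-a)²/a, affine in m, so rescaling m yields a Jacobi sum. The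
last two terms cover n = 1 and a = 1, where one coefficient vanishes. -/
lemma sum_mulChar_mul_quadChar_affine (χ : MulChar K ℂ) {a n : K} (ha : a ≠ 0) :
    ∑ m : K, χ m * quadChar K ((1 - n) ^ 2 + 2 * m - m * a - m * a⁻¹) =
      χ a * (χ ^ 2) (1 - n) * (χ ^ 2)⁻¹ (1 - a) * jacobiSum χ (quadChar K) +
      (if n = 1 then (if a = 1 then 0 else
        quadChar K (-1) * quadChar K a * ∑ m : K, (χ * quadChar K) m) else 0) +
      (if a = 1 then (if n = 1 then 0 else ∑ m : K, χ m) else 0) := by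
  have e (m : K) : (1 - n) ^ 2 + 2 * m - m * a - m * a⁻¹ =
      (1 - n) ^ 2 - m * ((1 - a) ^ 2 * a⁻¹) := by
    field_simp; ring
  simp only [e]
  by_cases hn : n = 1
  · by_cases ha1 : a = 1
    · simp [hn, ha1, MulChar.map_zero]
    · have h1 : 1 - a ≠ 0 := sub_ne_zero.2 (Ne.symm ha1)
      simp only [hn, ha1, sub_self, MulChar.map_zero, if_true, if_false, mul_zero, zero_mul,
        zero_add, add_zero, mul_sum]
      refine sum_congr rfl fun m _ => ?_
      rw [show (0 : K) ^ 2 - m * ((1 - a) ^ 2 * a⁻¹) = (1 - a) ^ 2 * (-1 * (m * a⁻¹)) by ring,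
        quadChar_sq_mul h1, map_mul, map_mul, quadChar_inv_apply, MulChar.mul_apply]
      ring
  · have hn1 : 1 - n ≠ 0 := sub_ne_zero.2 (Ne.symm hn)
    by_cases ha1 : a = 1
    · simp [hn, ha1, quadChar_pow_two hn1, MulChar.map_zero]
    · have h1 : 1 - a ≠ 0 := sub_ne_zero.2 (Ne.symm ha1)
      simp only [hn, ha1, if_false, add_zero]
      have hd : (1 - a) ^ 2 * a⁻¹ * ((1 - n) ^ 2)⁻¹ ≠ 0 :=
        mul_ne_zero (mul_ne_zero (pow_ne_zero _ h1) (inv_ne_zero ha))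
          (inv_ne_zero (pow_ne_zero _ hn1))
      have h := sum_mulChar_mul_comp χ (fun y => quadChar K (1 - y)) hd
      have e2 (m : K) : quadChar K ((1 - n) ^ 2 - m * ((1 - a) ^ 2 * a⁻¹)) =
          quadChar K (1 - m * ((1 - a) ^ 2 * a⁻¹ * ((1 - n) ^ 2)⁻¹)) := by
        rw [← quadChar_sq_mul hn1 (1 - _)]
        congr 1
        field_simp
      simp only [e2]
      rw [h, jacobiSum]
      congr 1
      simp only [MulChar.inv_apply', inv_inv, map_mul, MulChar.pow_apply' χ two_ne_zero, ← inv_pow, map_pow,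
        MulChar.pow_apply' χ⁻¹ two_ne_zero]
      ring

/-- Substitute n = ym and sum over m first; the sums over a and n then separate. The two correction
terms can be nonzero only if αβν is φ or trivial. -/
lemma mellin_cubicSum {α β : MulChar K ℂ} (h : α * β⁻¹ * quadChar K ≠ 1) (ν : MulChar K ℂ) :
    mellin (cubicSum α β) ν =
      jacobiSum (α * β * ν) (quadChar K) * jacobiSum (α ^ 2 * ν) ((α * β * ν) ^ 2)⁻¹ *
        jacobiSum ν⁻¹ ((α * β * ν) ^ 2) -
      quadChar K (-1) * ∑ m : K, (α * β * ν * quadChar K) m +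
      (∑ m : K, (α * β * ν) m) * (∑ m : K, ν⁻¹ m - 1) := by
  have e1 : mellin (cubicSum α β) ν = ∑ n : K, ∑ a : K, ν⁻¹ n * (α * β⁻¹) a *
      ∑ m : K, (α * β * ν) m * quadChar K ((1 - n) ^ 2 + 2 * m - m * a - m * a⁻¹) := by
    calc mellin (cubicSum α β) ν
        = ∑ m : K, ∑ a : K, (α * β) m * (α * β⁻¹) a *
            ∑ y : K, ν⁻¹ y * quadChar K ((1 - y * m) ^ 2 + 2 * m - m * a - m * a⁻¹) := by
          simp only [mellin, cubicSum, fiberForm, mul_sum]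
          rw [sum_comm]
          refine sum_congr rfl fun m _ => ?_
          rw [sum_comm]
          exact sum_congr rfl fun a _ => sum_congr rfl fun y _ => by ring
      _ = ∑ m : K, ∑ a : K, (α * β) m * (α * β⁻¹) a *
            (ν m * ∑ n : K, ν⁻¹ n * quadChar K ((1 - n) ^ 2 + 2 * m - m * a - m * a⁻¹)) := by
          refine sum_congr rfl fun m _ => sum_congr rfl fun a _ => ?_
          by_cases hm : m = 0
          · simp [hm, MulChar.map_zero]
          · have := sum_mulChar_mul_comp ν⁻¹
              (fun y => quadChar K ((1 - y) ^ 2 + 2 * m - m * a - m * a⁻¹)) hm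
            rw [inv_inv] at this
            rw [this]
      _ = _ := by
          simp only [mul_sum]
          rw [sum_comm]
          conv_rhs => rw [sum_comm]
          refine sum_congr rfl fun a _ => ?_
          rw [sum_comm]
          refine sum_congr rfl fun n _ => sum_congr rfl fun m _ => ?_
          rw [MulChar.mul_apply (α * β) ν]
          ring
  have e2 (n a : K) : ν⁻¹ n * (α * β⁻¹) a *
      ∑ m : K, (α * β * ν) m * quadChar K ((1 - n) ^ 2 + 2 * m - m * a - m * a⁻¹) =
      jacobiSum (α * β * ν) (quadChar K) * (((α ^ 2 * ν) a * ((α * β * ν) ^ 2)⁻¹ (1 - a)) *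
        (ν⁻¹ n * ((α * β * ν) ^ 2) (1 - n))) +
      (if n = 1 then quadChar K (-1) * (∑ m : K, (α * β * ν * quadChar K) m) *
        ((α * β⁻¹ * quadChar K) a - if a = 1 then 1 else 0) else 0) +
      (if a = 1 then (∑ m : K, (α * β * ν) m) * (ν⁻¹ n - if n = 1 then 1 else 0) else 0) := by
    by_cases ha : a = 0
    · simp [ha, MulChar.map_zero]
    · rw [sum_mulChar_mul_quadChar_affine _ ha]
      have h2 : (α ^ 2 * ν) a = (α * β⁻¹) a * (α * β * ν) a := by
        rw [← MulChar.mul_apply]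
        congr 1
        rw [show α * β⁻¹ * (α * β * ν) = (α ^ 2 * ν) * (β⁻¹ * β) by rw [sq]; ac_rfl,
          inv_mul_cancel, mul_one]
      rw [h2, MulChar.mul_apply (α * β⁻¹) (quadChar K)]
      by_cases hn : n = 1 <;> by_cases ha1 : a = 1
      · simp [hn, ha1, MulChar.map_zero]
      · simp [hn, ha1, MulChar.map_zero]; ring
      · simp [hn, ha1, MulChar.map_zero]; ring
      · simp [hn, ha1]; ring
  rw [e1]
  simp only [e2, sum_add_distrib]
  have e3 : ∑ n : K, ∑ a : K, jacobiSum (α * β * ν) (quadChar K) *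
      (((α ^ 2 * ν) a * ((α * β * ν) ^ 2)⁻¹ (1 - a)) * (ν⁻¹ n * ((α * β * ν) ^ 2) (1 - n))) =
      jacobiSum (α * β * ν) (quadChar K) * jacobiSum (α ^ 2 * ν) ((α * β * ν) ^ 2)⁻¹ *
        jacobiSum ν⁻¹ ((α * β * ν) ^ 2) := by
    simp only [← mul_sum, ← sum_mul]
    simp only [jacobiSum, mul_assoc]
  rw [e3]
  have e4 : ∑ n : K, ∑ a : K, (if n = 1 then quadChar K (-1) *
      (∑ m : K, (α * β * ν * quadChar K) m) *
        ((α * β⁻¹ * quadChar K) a - if a = 1 then 1 else 0) else 0) =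
      -(quadChar K (-1) * ∑ m : K, (α * β * ν * quadChar K) m) := by
    rw [sum_comm]
    simp only [sum_ite_eq', mem_univ, if_true, ← mul_sum, sum_sub_distrib,
      MulChar.sum_eq_zero_of_ne_one h]
    ring
  have e5 : ∑ n : K, ∑ a : K, (if a = 1 then (∑ m : K, (α * β * ν) m) *
      (ν⁻¹ n - if n = 1 then 1 else 0) else 0) =
      (∑ m : K, (α * β * ν) m) * (∑ m : K, ν⁻¹ m - 1) := by
    simp only [sum_ite_eq', mem_univ, if_true, ← mul_sum, sum_sub_distrib]
  rw [e4, e5]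
  ring

lemma quadChar_g_sq (hK : ringChar K ≠ 2) {ψ : AddChar K ℂ} (hψ : ψ ≠ 1) :
    g ψ (quadChar K) * g ψ (quadChar K) = quadChar K (-1) * Fintype.card K := by
  have h := gCirc_mul_g_inv hψ (quadChar K)
  rwa [quadChar_inv, gCirc_of_ne_one ψ (quadChar_ne_one hK)] at h

lemma mulChar_neg_one_sq_mul (α ν : MulChar K ℂ) : (α ^ 2 * ν) (-1) = ν (-1) := by
  rw [MulChar.mul_apply, sq, MulChar.mul_apply, mulChar_neg_one_sq, one_mul]

lemma jacobiSum_one_right (χ : MulChar K ℂ) :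
    jacobiSum χ 1 = if χ = 1 then (Fintype.card K : ℂ) - 2 else -1 := by
  split_ifs with h
  · rw [h, jacobiSum_one_one]
  · rw [jacobiSum_comm, jacobiSum_one_nontrivial h]

lemma g_mul_g_inv {ψ : AddChar K ℂ} (hψ : ψ ≠ 1) (χ : MulChar K ℂ) :
    g ψ χ * g ψ χ⁻¹ = if χ = 1 then 1 else χ (-1) * Fintype.card K := by
  split_ifs with h
  · simp [h, g_one hψ]
  · rw [← gCirc_mul_g_inv hψ, gCirc_of_ne_one ψ h]

lemma gCirc_mul_gCirc_inv {ψ : AddChar K ℂ} (hψ : ψ ≠ 1) (χ : MulChar K ℂ) :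
    gCirc ψ χ * gCirc ψ χ⁻¹ =
      if χ = 1 then (Fintype.card K : ℂ) ^ 2 else χ (-1) * Fintype.card K := by
  split_ifs with h
  · rw [h, inv_one, gCirc_one hψ, sq]
  · rw [← gCirc_mul_g_inv hψ, gCirc_of_ne_one ψ (χ := χ⁻¹) (by simpa using h)]

lemma mellin_cubicSum_eq_g (hK : ringChar K ≠ 2) {ψ : AddChar K ℂ} (hψ : ψ ≠ 1)
    {α β : MulChar K ℂ} (hαβ : α * β ≠ 1) (h : α * β⁻¹ * quadChar K ≠ 1)
    (ν : MulChar K ℂ) :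
    mellin (cubicSum α β) ν = -(Fintype.card K * g ψ (quadChar K) * g ψ (α * β * ν) *
      g ψ (α ^ 2 * ν) * g ψ (β ^ 2 * ν)) / (gCirc ψ ν * gCirc ψ (α * β * quadChar K * ν) *
        gCirc ψ (α ^ 2 * β ^ 2 * ν)) := by
  have hφ := quadChar_ne_one hK
  have hq := card_cast_ne_zero (K := K)
  have eβ : β ^ 2 * ν = (α ^ 2 * ν)⁻¹ * (α * β * ν) ^ 2 := by
    rw [eq_inv_mul_iff_mul_eq]; simp only [sq]; ac_rfl
  have eαβ : α ^ 2 * β ^ 2 * ν = ν⁻¹ * (α * β * ν) ^ 2 := by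
    rw [eq_inv_mul_iff_mul_eq]; simp only [sq]; ac_rfl
  have eγ : α * β * quadChar K * ν = α * β * ν * quadChar K := by ac_rfl
  have hsgn : (α ^ 2 * ν) (-1) = ν (-1) := mulChar_neg_one_sq_mul α ν
  rw [mellin_cubicSum h, eq_div_iff (mul_ne_zero (mul_ne_zero (gCirc_ne_zero hψ _)
    (gCirc_ne_zero hψ _)) (gCirc_ne_zero hψ _)), eγ]
  -- When αβν has order at most two, Jacobi sums with a trivial entry occur and the correction terms
  -- compensate for their exceptional values. Otherwise the corrections vanish and the Gauss sum
  -- formulas apply directly.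
  by_cases hX : (α * β * ν) ^ 2 = 1
  · have hβ : g ψ (α ^ 2 * ν) * g ψ (β ^ 2 * ν) = if α ^ 2 * ν = 1 then 1 else
        ν (-1) * Fintype.card K := by
      rw [eβ, hX, mul_one, g_mul_g_inv hψ, hsgn]
    have hν : gCirc ψ ν * gCirc ψ (α ^ 2 * β ^ 2 * ν) =
        if ν = 1 then (Fintype.card K : ℂ) ^ 2 else ν (-1) * Fintype.card K := by
      rw [eαβ, hX, mul_one, gCirc_mul_gCirc_inv hψ]
    rw [hX, inv_one, jacobiSum_one_right, jacobiSum_one_right]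
    rcases eq_one_or_eq_quadChar hK hX with hX1 | hX1
    · have hν1 : ν ≠ 1 := by
        rintro rfl
        exact hαβ (by simpa using hX1)
      rw [if_neg hν1] at hν
      rw [hX1, one_mul, g_one hψ, gCirc_of_ne_one ψ hφ, jacobiSum_one_nontrivial hφ,
        if_neg (inv_ne_one.2 hν1), MulChar.sum_eq_zero_of_ne_one hφ, sum_one_mulChar,
        MulChar.sum_eq_zero_of_ne_one (inv_ne_one.2 hν1)]
      have hν2 := mulChar_neg_one_ne_zero ν
      split_ifs at hβ ⊢ with h1
      · have hs : ν (-1) = 1 := by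
          rw [← hsgn, h1, MulChar.one_apply (by simp)]
        rw [hs] at hν
        linear_combination (-1) * g ψ (quadChar K) * hν +
          Fintype.card K * g ψ (quadChar K) * hβ
      · linear_combination (-(Fintype.card K : ℂ)) * g ψ (quadChar K) * hν +
          Fintype.card K * g ψ (quadChar K) * hβ
    -- If αβν = φ, then α²ν = αβ⁻¹φ, which `h` makes non-trivial.
    · have h1 : α ^ 2 * ν ≠ 1 := by
        intro h1
        apply h
        have : α * β⁻¹ * quadChar K = (α * β⁻¹) * (α * β * ν) := by rw [hX1]
        rw [this, show α * β⁻¹ * (α * β * ν) = (α ^ 2 * ν) * (β⁻¹ * β) by rw [sq]; ac_rfl, h1,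
          inv_mul_cancel, mul_one]
      rw [if_neg h1] at hβ
      have hg := quadChar_g_sq hK hψ
      have hJ := jacobiSum_nontrivial_inv hφ
      rw [quadChar_inv] at hJ
      rw [hX1, quadChar_mul_self, gCirc_one hψ, if_neg h1, hJ,
        MulChar.sum_eq_zero_of_ne_one hφ, sum_one_mulChar]
      simp only [inv_eq_one]
      split_ifs at hν ⊢ with hν1
      · have hs : ν (-1) = 1 := by rw [hν1, MulChar.one_apply (by simp)]
        rw [hs] at hβ
        linear_combination (-(Fintype.card K : ℂ)) * quadChar K (-1) * hν +
          Fintype.card K * g ψ (quadChar K) * g ψ (quadChar K) * hβ +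
          (Fintype.card K : ℂ) ^ 2 * hg
      · linear_combination (-(Fintype.card K : ℂ) ^ 2) * quadChar K (-1) * hν +
          Fintype.card K * g ψ (quadChar K) * g ψ (quadChar K) * hβ +
          (Fintype.card K : ℂ) ^ 2 * ν (-1) * hg
  · have hX1 : α * β * ν ≠ 1 := by
      intro h1
      exact hX (by rw [h1, one_pow])
    have hX2 := mul_quadChar_ne_one hX
    have e1 : α ^ 2 * ν * ((α * β * ν) ^ 2)⁻¹ = (β ^ 2 * ν)⁻¹ := by
      rw [eβ, mul_inv, inv_inv]
    rw [MulChar.sum_eq_zero_of_ne_one hX1, MulChar.sum_eq_zero_of_ne_one hX2,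
      jacobiSum_eq_g hψ _ _ (Or.inl hX1), jacobiSum_eq_g hψ _ _ (Or.inr (inv_ne_one.2 hX)),
      jacobiSum_eq_g hψ _ _ (Or.inr hX), e1, ← eαβ, gCirc_inv hψ, g_inv hψ, g_inv hψ,
      gCirc_of_ne_one ψ hX, mulChar_neg_one_sq_mul β ν]
    have hs : ((α * β * ν) ^ 2) (-1) = 1 := by
      rw [sq, MulChar.mul_apply, mulChar_neg_one_sq]
    rw [hs]
    have h1 := gCirc_ne_zero hψ ν
    have h2 := gCirc_ne_zero hψ (α * β * ν * quadChar K)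
    have h3 := gCirc_ne_zero hψ (α ^ 2 * β ^ 2 * ν)
    have h4 := g_ne_zero hψ ((α * β * ν) ^ 2)
    have h5 := g_ne_zero hψ (β ^ 2 * ν)
    have h6 := mulChar_neg_one_ne_zero ν
    field_simp
    ring

lemma hypF_three_two_eq (hK : ringChar K ≠ 2) {ψ : AddChar K ℂ} (hψ : ψ ≠ 1)
    {α β : MulChar K ℂ} (hα : α ^ 2 ≠ 1) (hβ : β ^ 2 ≠ 1) (hαβ : α * β ≠ 1)
    (h : α * β⁻¹ * quadChar K ≠ 1) {x : K} (hx : x ≠ 0) :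
    hypF ψ {α ^ 2, β ^ 2, α * β} {α ^ 2 * β ^ 2, α * β * quadChar K} x =
      gCirc ψ (α * β * quadChar K) ^ 2 /
        (g ψ α * g ψ β * g ψ (α * quadChar K) * g ψ (β * quadChar K)) * cubicSum α β x := by
  refine hyp_eq_of_mellin ψ _ _ _ _ (fun ν => ?_) hx
  -- Duplication for α, β and αβ; the values at 4 cancel by multiplicativity.
  have key : gCirc ψ (α ^ 2 * β ^ 2) *
      (g ψ α * g ψ β * g ψ (α * quadChar K) * g ψ (β * quadChar K)) =
      gCirc ψ (α * β * quadChar K) * g ψ (quadChar K) * g ψ (α ^ 2) * g ψ (β ^ 2) *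
        g ψ (α * β) := by
    have dup {χ : MulChar K ℂ} (h2 : χ ^ 2 ≠ 1) :
        g ψ χ * g ψ (χ * quadChar K) = χ⁻¹ 4 * g ψ (quadChar K) * g ψ (χ ^ 2) := by
      have h1 : χ ≠ 1 := by rintro rfl; simp at h2
      have h3 := mul_quadChar_ne_one h2
      have := g_mul_gCirc_quadChar hK hψ h1
      rwa [gCirc_of_ne_one ψ h2, gCirc_of_ne_one ψ h3] at this
    have h3 := g_mul_gCirc_quadChar hK hψ hαβ
    rw [mul_pow, mul_inv, MulChar.mul_apply] at h3
    linear_combination gCirc ψ (α ^ 2 * β ^ 2) * (g ψ β * g ψ (β * quadChar K)) * dup hα +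
      gCirc ψ (α ^ 2 * β ^ 2) * α⁻¹ 4 * g ψ (quadChar K) * g ψ (α ^ 2) * dup hβ -
      g ψ (quadChar K) * g ψ (α ^ 2) * g ψ (β ^ 2) * h3
  rw [mellin_cubicSum_eq_g hK hψ hαβ h]
  have h1 := g_ne_zero hψ α
  have h2 := g_ne_zero hψ β
  have h3 := g_ne_zero hψ (α * quadChar K)
  have h4 := g_ne_zero hψ (β * quadChar K)
  have h5 := gCirc_ne_zero hψ (α * β * quadChar K)
  have h6 := gCirc_ne_zero hψ ν
  have h7 := gCirc_ne_zero hψ (α * β * quadChar K * ν)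
  have h8 := gCirc_ne_zero hψ (α ^ 2 * β ^ 2 * ν)
  have h9 := gCirc_ne_zero hψ (α ^ 2 * β ^ 2)
  have h10 := g_ne_zero hψ (α ^ 2)
  have h11 := g_ne_zero hψ (β ^ 2)
  have h12 := g_ne_zero hψ (α * β)
  simp only [pochParam, pochCircParam, Multiset.insert_eq_cons, Multiset.map_cons,
    Multiset.map_singleton, Multiset.prod_cons, Multiset.prod_singleton, Multiset.map_add,
    Multiset.prod_add, poch, pochCirc, gCirc_one hψ, one_mul]
  field_simp
  linear_combination g ψ (α ^ 2 * ν) * g ψ (β ^ 2 * ν) * g ψ (α * β * ν) * key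

/-! ### The fibres of the character sums -/

/-- The sum of the quadratic character of `fiberForm` over the square roots of `a * b`. -/
def sqrtSum (x a b : K) : ℂ :=
  ∑ m : K, if m ^ 2 = a * b then quadChar K (fiberForm x m a b) else 0

/-- The change of variables (m, a) ↦ (ma, m/a), whose coordinates have product m². -/
lemma cubicSum_eq_sum_sqrtSum (α β : MulChar K ℂ) (x : K) :
    cubicSum α β x = ∑ a : K, ∑ b : K, α a * β b * sqrtSum x a b := by
  have e : ∀ a b : K, α a * β b * sqrtSum x a b = ∑ m : K,
      if m ^ 2 = a * b then α a * β b * quadChar K (fiberForm x m a b) else 0 := fun a b => by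
    rw [sqrtSum, mul_sum]
    exact sum_congr rfl fun m _ => by rw [mul_ite, mul_zero]
  simp only [e]
  have e2 : ∑ a : K, ∑ b : K, ∑ m : K,
      (if m ^ 2 = a * b then α a * β b * quadChar K (fiberForm x m a b) else 0) =
      ∑ m : K, ∑ a : K, ∑ b : K,
      (if m ^ 2 = a * b then α a * β b * quadChar K (fiberForm x m a b) else 0) :=
    (sum_congr rfl fun a _ => sum_comm).trans sum_comm
  rw [e2, cubicSum]
  refine sum_congr rfl fun m _ => ?_
  by_cases hm : m = 0
  · subst hm
    simp only [MulChar.map_zero, zero_mul, sum_const_zero]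
    refine (sum_eq_zero fun a _ => sum_eq_zero fun b _ => ?_).symm
    split_ifs with h
    · have : a = 0 ∨ b = 0 := by
        rw [← mul_eq_zero, ← h]; simp
      rcases this with rfl | rfl <;> simp [MulChar.map_zero]
    · rfl
  · refine Fintype.sum_equiv (Equiv.mulLeft₀ m hm) _ _ fun a => ?_
    have : Equiv.mulLeft₀ m hm a = m * a := rfl
    rw [this]
    by_cases ha : a = 0
    · simp [ha, MulChar.map_zero]
    · have e3 (b : K) : m ^ 2 = m * a * b ↔ b = m * a⁻¹ := by
        constructor
        · intro h
          have : m * m = m * (a * b) := by linear_combination h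
          rw [mul_left_cancel₀ hm this]
          field_simp
        · rintro rfl
          field_simp
      simp only [e3, sum_ite_eq', mem_univ, if_true]
      rw [map_mul, map_mul, MulChar.mul_apply, MulChar.mul_apply, MulChar.inv_apply']
      ring

/-- Euler's transformation of the character sum `eulerSum`. -/
lemma eulerSum_comm_eq (α β : MulChar K ℂ) {x : K} (hx1 : x ≠ 1) :
    eulerSum β α x = quadChar K (1 - x) *
      ∑ t : K, (β * quadChar K) t * α (1 - t) * (α * quadChar K)⁻¹ (1 - x * t) := by
  have h1 : 1 - x ≠ 0 := sub_ne_zero.2 (Ne.symm hx1)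
  have hL : eulerSum β α x = ∑ v ∈ univ.filter (fun v : K => 1 - x * v ≠ 0),
      α v * (β * quadChar K) (1 - v) * β⁻¹ (1 - x * v) := by
    rw [eulerSum, sum_filter_of_ne]
    intro v _ hv h0
    exact hv (by rw [h0, MulChar.map_zero, mul_zero])
  have hR : ∑ t : K, (β * quadChar K) t * α (1 - t) * (α * quadChar K)⁻¹ (1 - x * t) =
      ∑ t ∈ univ.filter (fun v : K => 1 - x * v ≠ 0),
        (β * quadChar K) t * α (1 - t) * (α * quadChar K)⁻¹ (1 - x * t) := by
    rw [sum_filter_of_ne]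
    intro v _ hv h0
    exact hv (by rw [h0, MulChar.map_zero, mul_zero])
  have hx' {t : K} (ht : 1 - x * t ≠ 0) :
      1 - x * ((1 - t) / (1 - x * t)) = (1 - x) / (1 - x * t) := by
    rw [eq_div_iff ht, sub_mul, mul_assoc, div_mul_cancel₀ _ ht]; ring
  have hx'' {t : K} (ht : 1 - x * t ≠ 0) :
      1 - (1 - t) / (1 - x * t) = t * ((1 - x) / (1 - x * t)) := by
    rw [div_eq_mul_inv, div_eq_mul_inv]
    linear_combination -(mul_inv_cancel₀ ht)
  have hmem {t : K} (ht : 1 - x * t ≠ 0) : 1 - x * ((1 - t) / (1 - x * t)) ≠ 0 := by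
    rw [hx' ht]; exact div_ne_zero h1 ht
  have hinv {t : K} (ht : 1 - x * t ≠ 0) :
      (1 - (1 - t) / (1 - x * t)) / (1 - x * ((1 - t) / (1 - x * t))) = t := by
    rw [hx' ht, hx'' ht, mul_div_cancel_right₀ _ (div_ne_zero h1 ht)]
  rw [hL, hR, mul_sum]
  -- This Möbius map is an involution exchanging 0 and 1, so the roles of t and 1 - t are
  -- interchanged.
  refine sum_nbij' (fun t => (1 - t) / (1 - x * t)) (fun t => (1 - t) / (1 - x * t))
    ?_ ?_ ?_ ?_ ?_
  · intro t ht
    simp only [mem_filter, mem_univ, true_and] at ht ⊢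
    exact hmem ht
  · intro t ht
    simp only [mem_filter, mem_univ, true_and] at ht ⊢
    exact hmem ht
  · intro t ht
    simp only [mem_filter, mem_univ, true_and] at ht
    exact hinv ht
  · intro t ht
    simp only [mem_filter, mem_univ, true_and] at ht
    exact hinv ht
  · intro t ht
    simp only [mem_filter, mem_univ, true_and] at ht
    rw [hx' ht, hx'' ht]
    have a1 : α (1 - x) * α (1 - x)⁻¹ = 1 := by rw [← map_mul, mul_inv_cancel₀ h1, map_one]
    have a2 : α (1 - x * t) * α (1 - x * t)⁻¹ = 1 := by
      rw [← map_mul, mul_inv_cancel₀ ht, map_one]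
    have a3 := quadChar_sq h1
    have a4 := quadChar_sq ht
    simp only [map_mul, MulChar.mul_apply, MulChar.inv_apply', div_eq_mul_inv, mul_inv, inv_inv,
      quadChar_inv_apply]
    calc _ = α t * (β (1 - t) * quadChar K (1 - t)) * β (1 - x * t)⁻¹ *
          ((α (1 - x) * α (1 - x)⁻¹) * (α (1 - x * t) * α (1 - x * t)⁻¹) *
          (quadChar K (1 - x) * quadChar K (1 - x)) *
          (quadChar K (1 - x * t) * quadChar K (1 - x * t))) := by
          rw [a1, a2, a3, a4]; ring
      _ = _ := by ring

/-- The contribution of a fibre to the product of two Euler-type sums. -/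
def fiberSum (x a b : K) : ℂ :=
  ∑ t : K, ∑ u : K, if t * u = b ∧ (1 - t) * (1 - u) / ((1 - x * t) * (1 - x * u)) = a then
    quadChar K ((1 - x) * ((1 - t) * u * (1 - x * u))) else 0

lemma eulerSum_mul_eulerSum (α β : MulChar K ℂ) {x : K} (hx1 : x ≠ 1) :
    eulerSum α β x * eulerSum β α x = ∑ a : K, ∑ b : K, α a * β b * fiberSum x a b := by
  rw [eulerSum_comm_eq α β hx1]
  have e : ∀ a b : K, α a * β b * fiberSum x a b = ∑ t : K, ∑ u : K,
      if t * u = b ∧ (1 - t) * (1 - u) / ((1 - x * t) * (1 - x * u)) = a then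
      α a * β b * quadChar K ((1 - x) * ((1 - t) * u * (1 - x * u))) else 0 := fun a b => by
    simp only [fiberSum, mul_sum, mul_ite, mul_zero]
  have e2 (t u : K) : β t * (α * quadChar K) (1 - t) * α⁻¹ (1 - x * t) * (quadChar K (1 - x) *
      ((β * quadChar K) u * α (1 - u) * (α * quadChar K)⁻¹ (1 - x * u))) =
      ∑ a : K, ∑ b : K,
      if t * u = b ∧ (1 - t) * (1 - u) / ((1 - x * t) * (1 - x * u)) = a then
      α a * β b * quadChar K ((1 - x) * ((1 - t) * u * (1 - x * u))) else 0 := by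
    -- If a denominator vanishes the quotient is 0 by convention, and α(0) = 0 agrees with the
    -- vanishing factor on the left.
    simp only [ite_and, sum_ite_eq, mem_univ, if_true]
    simp only [map_mul, MulChar.mul_apply, MulChar.inv_apply', div_eq_mul_inv, mul_inv,
      quadChar_inv_apply]
    ring
  simp only [e]
  rw [eulerSum, mul_sum univ _ (quadChar K (1 - x)), sum_mul_sum]
  simp only [e2]
  calc _ = ∑ t : K, ∑ a : K, ∑ u : K, ∑ b : K,
      (if t * u = b ∧ (1 - t) * (1 - u) / ((1 - x * t) * (1 - x * u)) = a then
      α a * β b * quadChar K ((1 - x) * ((1 - t) * u * (1 - x * u))) else 0) :=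
        sum_congr rfl fun t _ => sum_comm
    _ = ∑ a : K, ∑ t : K, ∑ u : K, ∑ b : K,
      (if t * u = b ∧ (1 - t) * (1 - u) / ((1 - x * t) * (1 - x * u)) = a then
      α a * β b * quadChar K ((1 - x) * ((1 - t) * u * (1 - x * u))) else 0) := sum_comm
    _ = ∑ a : K, ∑ t : K, ∑ b : K, ∑ u : K,
      (if t * u = b ∧ (1 - t) * (1 - u) / ((1 - x * t) * (1 - x * u)) = a then
      α a * β b * quadChar K ((1 - x) * ((1 - t) * u * (1 - x * u))) else 0) :=
        sum_congr rfl fun a _ => sum_congr rfl fun t _ => sum_comm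
    _ = _ := sum_congr rfl fun a _ => sum_comm

/-! ### Evaluation of the fibres -/

lemma fiberForm_comm (x m a b : K) : fiberForm x m a b = fiberForm x m b a := by
  simp only [fiberForm]; ring

lemma sqrtSum_comm (x a b : K) : sqrtSum x a b = sqrtSum x b a := by
  simp only [sqrtSum, fiberForm_comm x _ a b, mul_comm a b]

/-- For x ≠ 1 this forces 1 - xa and 1 - xtu to vanish together on a fibre. -/
lemma mul_sub_eq_of_fiber {x a t u : K} (ht : 1 - x * t ≠ 0) (hu : 1 - x * u ≠ 0)
    (h : (1 - t) * (1 - u) / ((1 - x * t) * (1 - x * u)) = a) :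
    (1 - x * t) * (1 - x * u) * (1 - x * a) = (1 - x) * (1 - x * (t * u)) := by
  rw [← h]; field_simp; ring

lemma ne_zero_of_fiber {x a t u : K} (ha : a ≠ 0)
    (h : (1 - t) * (1 - u) / ((1 - x * t) * (1 - x * u)) = a) :
    (1 - t ≠ 0 ∧ 1 - u ≠ 0) ∧ 1 - x * t ≠ 0 ∧ 1 - x * u ≠ 0 := by
  refine ⟨⟨?_, ?_⟩, ?_, ?_⟩ <;>
  · intro h0
    apply ha
    rw [← h, h0]
    simp

/-- On a generic fibre, the quadratic character is read off from a square root of `a * b`. -/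
lemma quadChar_fiber_eq {x a t u m : K} (hx1 : 1 - x ≠ 0) (ha : a ≠ 0) (htu : t * u ≠ 0)
    (h : (1 - t) * (1 - u) / ((1 - x * t) * (1 - x * u)) = a)
    (hm : m ^ 2 = a * (t * u)) (hf : fiberForm x m a (t * u) ≠ 0) (hxm : 1 + x * m ≠ 0) :
    quadChar K ((1 - x) * ((1 - t) * u * (1 - x * u))) =
      quadChar K (fiberForm x m a (t * u)) := by
  obtain ⟨⟨ht1, hu1⟩, htx, hux⟩ := ne_zero_of_fiber ha h
  have hd := mul_sub_eq_of_fiber htx hux h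
  have hu0 : u ≠ 0 := right_ne_zero_of_mul htu
  -- Put w = (1-t)u(1-xu), let w' be w with t and u exchanged, and D = (1-xt)(1-xu). The last factor
  -- is w + w' + 2mD.
  have key : (1 - x) * (fiberForm x m a (t * u) * (1 + x * m) ^ 2) = (1 - x * a) ^ 2 *
      ((1 - t) * u * (1 - x * u) + (1 - u) * t * (1 - x * t) +
        2 * m * ((1 - x * t) * (1 - x * u))) := by
    have e0 : (1 - x) * ((1 - a - t * u) + a * (t * u) * (x ^ 2 * (1 - a - t * u) + 4 * x -
        3 * x ^ 2 + x ^ 4 * (a * (t * u)))) =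
        (1 - x * a) ^ 2 * ((1 - t) * u * (1 - x * u) + (1 - u) * t * (1 - x * t)) := by
      rw [← h]; field_simp; ring
    have e1 : (1 - x) * (1 - x * (t * u)) * (1 - x * a) =
        (1 - x * a) ^ 2 * ((1 - x * t) * (1 - x * u)) := by
      linear_combination -(1 - x * a) * hd
    simp only [fiberForm]
    linear_combination e0 + 2 * m * e1 + (1 - x) * (x ^ 4 * m ^ 2 + 2 * x ^ 2 * m +
      (x ^ 2 * (1 - a - t * u) + 4 * x * (1 - x) + x ^ 2 + x ^ 4 * (a * (t * u)))) * hm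
  have hw : (1 - t) * u * (1 - x * u) ≠ 0 := mul_ne_zero (mul_ne_zero ht1 hu0) hux
  have hn : (1 - t) * (1 - u) = a * ((1 - x * t) * (1 - x * u)) := by
    exact (div_eq_iff (mul_ne_zero htx hux)).1 h
  -- Since ww' = a·tu·D² = (mD)², multiplying w + w' + 2mD by w gives the square (w + mD)².
  have key2 : (1 - x) * ((1 - t) * u * (1 - x * u)) * (fiberForm x m a (t * u) * (1 + x * m) ^ 2) =
      ((1 - x * a) * ((1 - t) * u * (1 - x * u) + m * ((1 - x * t) * (1 - x * u)))) ^ 2 := by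
    linear_combination (1 - t) * u * (1 - x * u) * key - (1 - x * a) ^ 2 *
      ((1 - x * t) * (1 - x * u)) ^ 2 * hm + (1 - x * a) ^ 2 * (t * u) *
      ((1 - x * t) * (1 - x * u)) * hn
  rw [quadChar_eq_of_mul_eq_sq _ key2, mul_comm, quadChar_sq_mul hxm]
  intro h0
  rw [h0, zero_pow two_ne_zero] at key2
  exact mul_ne_zero (mul_ne_zero hx1 hw) (mul_ne_zero hf (pow_ne_zero _ hxm)) key2

/-- Once tu = b, the condition on a is linear in t + u with leading coefficient 1 - xa, so t and u
are the roots of a fixed quadratic. -/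
lemma fiberSum_eq_sum_roots {x a b : K} (hx1 : 1 - x ≠ 0) (ha : a ≠ 0)
    (hxa : 1 - x * a ≠ 0) (hxb : 1 - x * b ≠ 0) :
    fiberSum x a b = ∑ t : K,
      if t ^ 2 - (1 + b - a - x ^ 2 * a * b) / (1 - x * a) * t + b = 0 then
      quadChar K ((1 - x) * ((1 - t) * ((1 + b - a - x ^ 2 * a * b) / (1 - x * a) - t) *
        (1 - x * ((1 + b - a - x ^ 2 * a * b) / (1 - x * a) - t)))) else 0 := by
  set s := (1 + b - a - x ^ 2 * a * b) / (1 - x * a) with hs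
  have hs' : s * (1 - x * a) = 1 + b - a - x ^ 2 * a * b := by
    rw [hs, div_mul_cancel₀ _ hxa]
  have e (t u : K) : (t * u = b ∧ (1 - t) * (1 - u) / ((1 - x * t) * (1 - x * u)) = a) ↔
      (u = s - t ∧ t ^ 2 - s * t + b = 0) := by
    constructor
    · rintro ⟨h1, h2⟩
      obtain ⟨_, htx, hux⟩ := ne_zero_of_fiber ha h2
      have h3 : (1 - t) * (1 - u) = a * ((1 - x * t) * (1 - x * u)) := by
        exact (div_eq_iff (mul_ne_zero htx hux)).1 h2
      have h4 : u = s - t := by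
        have : (1 - x * a) * (u - (s - t)) = 0 := by
          linear_combination (-1 : K) * hs' - h3 + (1 - x ^ 2 * a) * h1
        exact sub_eq_zero.1 ((mul_eq_zero.1 this).resolve_left hxa)
      refine ⟨h4, ?_⟩
      rw [← h1, h4]; ring
    · rintro ⟨rfl, h2⟩
      have h1 : t * (s - t) = b := by linear_combination -h2
      refine ⟨h1, ?_⟩
      have hd : (1 - x * t) * (1 - x * (s - t)) * (1 - x * a) = (1 - x) * (1 - x * b) := by
        linear_combination -x * hs' + x ^ 2 * (1 - x * a) * h1
      have hd0 : (1 - x * t) * (1 - x * (s - t)) ≠ 0 := by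
        intro h0
        rw [h0, zero_mul] at hd
        exact mul_ne_zero hx1 hxb hd.symm
      rw [div_eq_iff hd0]
      linear_combination -hs' + (1 - a * x ^ 2) * h1
  simp only [fiberSum, e, ite_and, sum_ite_eq', mem_univ, if_true]

lemma sqrtSum_eq_of_sq (hK : ringChar K ≠ 2) {x a b m : K} (hm : m ^ 2 = a * b) (hm0 : m ≠ 0) :
    sqrtSum x a b = quadChar K (fiberForm x m a b) + quadChar K (fiberForm x (-m) a b) := by
  have h2 : (2 : K) ≠ 0 := Ring.two_ne_zero hK
  have hne : m ≠ -m := by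
    intro h
    exact mul_ne_zero h2 hm0 (by linear_combination h)
  have e (n : K) : (if n ^ 2 = a * b then quadChar K (fiberForm x n a b) else 0) =
      (if n = m then quadChar K (fiberForm x m a b) else 0) +
      (if n = -m then quadChar K (fiberForm x (-m) a b) else 0) := by
    rw [← hm, sq_eq_sq_iff_eq_or_eq_neg]
    by_cases h1 : n = m
    · subst h1; simp [hne]
    · by_cases h2 : n = -m
      · subst h2; simp [hne.symm]
      · simp [h1, h2]
  simp only [sqrtSum, e, sum_add_distrib, sum_ite_eq', mem_univ, if_true]

/-- Every point of the fibre contributes φ(f(m)), and there are 1 + φ(f(m)f(-m)) points; multiply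
out. -/
lemma fiberSum_eq_of_sq (hK : ringChar K ≠ 2) {x a b m : K} (hx1 : 1 - x ≠ 0) (ha : a ≠ 0)
    (hb : b ≠ 0) (hxa : 1 - x * a ≠ 0) (hxb : 1 - x * b ≠ 0) (hm : m ^ 2 = a * b)
    (hf : fiberForm x m a b ≠ 0) (hxm : 1 + x * m ≠ 0) :
    fiberSum x a b = quadChar K (fiberForm x m a b) + quadChar K (fiberForm x (-m) a b) := by
  rw [fiberSum_eq_sum_roots hx1 ha hxa hxb]
  set s := (1 + b - a - x ^ 2 * a * b) / (1 - x * a) with hs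
  have hs' : s * (1 - x * a) = 1 + b - a - x ^ 2 * a * b := by
    rw [hs, div_mul_cancel₀ _ hxa]
  have e (t : K) : (if t ^ 2 - s * t + b = 0 then
      quadChar K ((1 - x) * ((1 - t) * (s - t) * (1 - x * (s - t)))) else 0) =
      quadChar K (fiberForm x m a b) * (if t ^ 2 - s * t + b = 0 then 1 else 0) := by
    split_ifs with h
    · have h1 : t * (s - t) = b := by linear_combination -h
      have hd : (1 - x * t) * (1 - x * (s - t)) * (1 - x * a) = (1 - x) * (1 - x * b) := by
        linear_combination -x * hs' + x ^ 2 * (1 - x * a) * h1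
      have hd0 : (1 - x * t) * (1 - x * (s - t)) ≠ 0 := by
        intro h0
        rw [h0, zero_mul] at hd
        exact mul_ne_zero hx1 hxb hd.symm
      have h2 : (1 - t) * (1 - (s - t)) / ((1 - x * t) * (1 - x * (s - t))) = a := by
        rw [div_eq_iff hd0]
        linear_combination -hs' + (1 - a * x ^ 2) * h1
      have := quadChar_fiber_eq (m := m) hx1 ha (by rwa [h1]) h2 (by rwa [h1]) (by rwa [h1]) hxm
      rw [this, h1, mul_one]
    · rw [mul_zero]
  simp only [e]
  rw [← mul_sum, sum_quadratic_roots hK, ← quadChar_sq_mul hxa (s ^ 2 - 4 * b)]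
  have hdisc : (1 - x * a) ^ 2 * (s ^ 2 - 4 * b) = fiberForm x m a b * fiberForm x (-m) a b := by
    simp only [fiberForm]
    linear_combination (s * (1 - x * a) + 1 + b - a - x ^ 2 * a * b) * hs' +
      (-x ^ 4 * (m ^ 2 + a * b) + 2 * x ^ 2 * (1 + a + b) + 4 - 8 * x) * hm
  rw [hdisc, map_mul]
  linear_combination quadChar K (fiberForm x (-m) a b) * quadChar_sq hf

lemma sqrtSum_eq_zero_of_not_isSquare {x a b : K} (h : ¬IsSquare (a * b)) :
    sqrtSum x a b = 0 :=
  sum_eq_zero fun m _ => if_neg fun hm => h ⟨m, by rw [← hm, sq]⟩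

/-- Exchanging t and u changes the sign of each summand: the two quadratic character values have
product φ(ab) = -1. -/
lemma fiberSum_eq_zero_of_not_isSquare {x a b : K} (hx1 : 1 - x ≠ 0) (ha : a ≠ 0)
    (h : ¬IsSquare (a * b)) : fiberSum x a b = 0 := by
  have hneg : fiberSum x a b = -fiberSum x a b := by
    conv_lhs => rw [fiberSum, sum_comm]
    rw [fiberSum, ← sum_neg_distrib]
    refine sum_congr rfl fun t _ => ?_
    rw [← sum_neg_distrib]
    refine sum_congr rfl fun u _ => ?_
    rw [mul_comm u t, mul_comm (1 - u), mul_comm (1 - x * u)]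
    split_ifs with h1
    · obtain ⟨h1, h2⟩ := h1
      obtain ⟨⟨ht1, hu1⟩, htx, hux⟩ := ne_zero_of_fiber ha h2
      have h3 := (div_eq_iff (mul_ne_zero htx hux)).1 h2
      have hz : (1 - x) * ((1 - x * t) * (1 - x * u)) ≠ 0 :=
        mul_ne_zero hx1 (mul_ne_zero htx hux)
      have hp : (1 - x) * ((1 - u) * t * (1 - x * t)) * ((1 - x) * ((1 - t) * u * (1 - x * u))) =
          ((1 - x) * ((1 - x * t) * (1 - x * u))) ^ 2 * (a * b) := by
        rw [← h1]
        linear_combination (1 - x) ^ 2 * (t * u) * ((1 - x * t) * (1 - x * u)) * h3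
      have hq := congrArg (quadChar K) hp
      rw [map_mul, quadChar_sq_mul hz, quadChar_of_not_isSquare h] at hq
      have hu0 : u ≠ 0 := by
        rintro rfl
        exact h (by rw [← h1]; simp)
      have := quadChar_sq (mul_ne_zero hx1 (mul_ne_zero (mul_ne_zero ht1 hu0) hux))
      linear_combination quadChar K ((1 - x) * ((1 - t) * u * (1 - x * u))) * hq -
        quadChar K ((1 - x) * ((1 - u) * t * (1 - x * t))) * this
    · rw [neg_zero]
  exact self_eq_neg.1 hneg

/-- The fibres agree away from the degenerate locus. -/
lemma fiberSum_eq_sqrtSum (hK : ringChar K ≠ 2) {x a b : K} (hx1 : 1 - x ≠ 0) (ha : a ≠ 0)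
    (hb : b ≠ 0) (hxa : 1 - x * a ≠ 0) (hxb : 1 - x * b ≠ 0) :
    fiberSum x a b = sqrtSum x a b := by
  by_cases h : IsSquare (a * b)
  · obtain ⟨m, hm⟩ := h
    rw [← sq] at hm
    have hm0 : m ≠ 0 := by
      rintro rfl
      exact mul_ne_zero ha hb (by rw [hm]; simp)
    -- One of the two roots ±m is always usable. If xn = 1, then x·f(n) = (1-xa)(1-xb) ≠ 0 and 1 +
    -- xn = 2. If neither root satisfies this, f(m) - f(-m) = 4m(1-x) prevents both values from
    -- vanishing.
    suffices H : ∃ n : K, n ^ 2 = a * b ∧ n ≠ 0 ∧ fiberForm x n a b ≠ 0 ∧ 1 + x * n ≠ 0 by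
      obtain ⟨n, hn, hn0, hf, hxn⟩ := H
      rw [sqrtSum_eq_of_sq hK hn hn0, fiberSum_eq_of_sq hK hx1 ha hb hxa hxb hn hf hxn]
    have h4 := four_ne_zero_of_ringChar hK
    have h2 : (2 : K) ≠ 0 := Ring.two_ne_zero hK
    have hspecial (n : K) (hn : n ^ 2 = a * b) (hxn : 1 - x * n = 0) :
        fiberForm x n a b ≠ 0 ∧ 1 + x * n ≠ 0 := by
      constructor
      · intro h0
        simp only [fiberForm] at h0
        refine mul_ne_zero hxa hxb ?_
        linear_combination x * h0 - x ^ 2 * hn + (x * n - 1 - x * (1 - x * n) + 2 * (1 - x * n)) * hxn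
      · intro h0
        exact h2 (by linear_combination hxn + h0)
    by_cases h1 : 1 - x * m = 0
    · exact ⟨m, hm.symm, hm0, hspecial m hm.symm h1⟩
    by_cases h3 : 1 + x * m = 0
    · exact ⟨-m, by rw [neg_sq, hm], neg_ne_zero.2 hm0,
        hspecial (-m) (by rw [neg_sq, hm]) (by linear_combination h3)⟩
    by_cases h5 : fiberForm x m a b = 0
    · refine ⟨-m, by rw [neg_sq, hm], neg_ne_zero.2 hm0, fun h6 => ?_, fun h7 => h1 ?_⟩
      · refine mul_ne_zero (mul_ne_zero h4 hm0) hx1 ?_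
        simp only [fiberForm] at h5 h6
        linear_combination h5 - h6
      · linear_combination h7
    · exact ⟨m, hm.symm, hm0, h5, h3⟩
  · rw [fiberSum_eq_zero_of_not_isSquare hx1 ha h, sqrtSum_eq_zero_of_not_isSquare h]

lemma quadChar_mul_right_eq_of_mul_eq_one {x a : K} (ha : x * a = 1) (b : K) :
    quadChar K (a * b) = quadChar K (x * b) := by
  have hx : x ≠ 0 := left_ne_zero_of_mul_eq_one ha
  rw [← quadChar_sq_mul hx (a * b)]
  congr 1
  linear_combination x * b * ha

/-- Here `fiberForm` collapses to (1-xm)²(1-x⁻¹), so each square root of ab counts equally except m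
= x⁻¹, which occurs only if xb = 1. -/
lemma sqrtSum_of_mul_eq_one (hK : ringChar K ≠ 2) {x a : K} (ha : x * a = 1) (b : K) :
    sqrtSum x a b = quadChar K (1 - x⁻¹) *
      (1 + quadChar K (x * b) - if x * b = 1 then 1 else 0) := by
  have hx : x ≠ 0 := left_ne_zero_of_mul_eq_one ha
  have e (m : K) : (if m ^ 2 = a * b then quadChar K (fiberForm x m a b) else 0) =
      quadChar K (1 - x⁻¹) * ((if m ^ 2 = a * b then 1 else 0) -
        if m = a then (if x * b = 1 then 1 else 0) else 0) := by
    by_cases hm : m ^ 2 = a * b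
    · have hf : fiberForm x m a b = (1 - x * m) ^ 2 * (1 - x⁻¹) := by
        rw [← eq_inv_of_mul_eq_one_right ha]
        simp only [fiberForm]
        linear_combination (x * m ^ 2 - 2 * m + b) * ha + x * hm
      by_cases hxm : 1 - x * m = 0
      · have hma : m = a := mul_left_cancel₀ hx (by linear_combination -hxm - ha)
        have hxb : x * b = 1 := by
          linear_combination -x ^ 2 * hm - (1 + x * m) * hxm - x * b * ha
        rw [if_pos hm, if_pos hm, if_pos hma, if_pos hxb, hf, hxm]
        simp [MulChar.map_zero]
      · have hma : m ≠ a := by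
          rintro rfl
          exact hxm (by linear_combination -ha)
        simp [hm, hf, hma, quadChar_sq_mul hxm]
    · have : ¬(m = a ∧ x * b = 1) := by
        rintro ⟨rfl, h⟩
        exact hm (mul_left_cancel₀ hx (by linear_combination m * ha - m * h))
      rw [← ite_and]
      simp [hm, this]
  simp only [sqrtSum, e]
  rw [← mul_sum, sum_sub_distrib, sum_sqrts hK, quadChar_mul_right_eq_of_mul_eq_one ha]
  simp

/-- A fibre over exactly one degenerate coordinate is empty. -/
lemma fiberSum_eq_zero_of_degenerate {x a b : K} (hx1 : 1 - x ≠ 0) (ha : a ≠ 0)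
    (h : ¬(x * a = 1 ↔ x * b = 1)) : fiberSum x a b = 0 := by
  refine sum_eq_zero fun t _ => sum_eq_zero fun u _ => if_neg ?_
  rintro ⟨h1, h2⟩
  obtain ⟨_, htx, hux⟩ := ne_zero_of_fiber ha h2
  have h3 := mul_sub_eq_of_fiber htx hux h2
  rw [h1] at h3
  apply h
  constructor
  · intro h4
    rw [h4, sub_self, mul_zero] at h3
    linear_combination -((mul_eq_zero.1 h3.symm).resolve_left hx1)
  · intro h4
    rw [h4, sub_self, mul_zero] at h3
    linear_combination -((mul_eq_zero.1 h3).resolve_left (mul_ne_zero htx hux))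

/-- When a = b = x⁻¹ the condition on a follows from tu = a, so the fibre is a curve: every t
outside {0, 1, a} contributes φ(1-x⁻¹). -/
lemma fiberSum_of_mul_eq_one {x a : K} (hx1 : 1 - x ≠ 0) (ha : x * a = 1) :
    fiberSum x a a = quadChar K (1 - x⁻¹) * (Fintype.card K - 3) := by
  have hx : x ≠ 0 := left_ne_zero_of_mul_eq_one ha
  have ha0 : a ≠ 0 := right_ne_zero_of_mul_eq_one ha
  have hax : x⁻¹ = a := (eq_inv_of_mul_eq_one_right ha).symm
  have ha1 : a ≠ 1 := by
    rintro rfl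
    exact hx1 (by linear_combination -ha)
  have e (t : K) : (∑ u : K, if t * u = a ∧
      (1 - t) * (1 - u) / ((1 - x * t) * (1 - x * u)) = a then
      quadChar K ((1 - x) * ((1 - t) * u * (1 - x * u))) else 0) =
      quadChar K (1 - x⁻¹) *
        (1 - (if t = 0 then 1 else 0) - (if t = 1 then 1 else 0) - (if t = a then 1 else 0)) := by
    rw [hax]
    by_cases h0 : t = 0
    · subst h0
      simp [ha0.symm]
    by_cases h1 : t = 1
    · subst h1
      simp [ha0.symm, ha1.symm]
    by_cases h2 : t = a
    · subst h2
      simp [ha, ha0, ha1, ha0.symm]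
    have e2 (u : K) : (t * u = a ∧ (1 - t) * (1 - u) / ((1 - x * t) * (1 - x * u)) = a) ↔
        u = a / t := by
      rw [eq_div_iff h0, mul_comm u t, and_iff_left_iff_imp]
      intro h3
      have h4 : 1 - x * t ≠ 0 := fun h => h2 (mul_left_cancel₀ hx (by linear_combination -h - ha))
      have h5 : 1 - x * u ≠ 0 := fun h => h1 <| by
        linear_combination t * h + ha + x * h3
      rw [div_eq_iff (mul_ne_zero h4 h5)]
      linear_combination (t + u - x * t * u - 1) * ha + (1 - x) * h3
    simp only [e2, sum_ite_eq', mem_univ, if_true, h0, h1, h2, if_false, sub_zero, mul_one]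
    have h6 : (1 - t) / t ≠ 0 := div_ne_zero (sub_ne_zero.2 (Ne.symm h1)) h0
    rw [← quadChar_sq_mul h6 (1 - a), show x * (a / t) = t⁻¹ by rw [mul_div_assoc', ha, one_div]]
    congr 1
    field_simp
    linear_combination (1 - t) * ha
  simp only [fiberSum, e]
  rw [← mul_sum]
  simp only [sum_sub_distrib, sum_ite_eq', mem_univ, if_true, sum_const, card_univ, nsmul_eq_mul,
    mul_one]
  ring

/-- Comparison of the fibres, including the degenerate ones. -/
lemma fiberSum_eq (hK : ringChar K ≠ 2) {x a b : K} (hx1 : 1 - x ≠ 0) (ha : a ≠ 0)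
    (hb : b ≠ 0) :
    fiberSum x a b = sqrtSum x a b + quadChar K (1 - x⁻¹) *
      ((if x * a = 1 then (if x * b = 1 then (Fintype.card K : ℂ) else 0) else 0) -
      (if x * b = 1 then 1 + quadChar K (x * a) else 0) -
      (if x * a = 1 then 1 + quadChar K (x * b) else 0)) := by
  by_cases h1 : x * a = 1 <;> by_cases h2 : x * b = 1
  · have : b = a := mul_left_cancel₀ (left_ne_zero_of_mul_eq_one h1) (h2.trans h1.symm)
    subst this
    rw [fiberSum_of_mul_eq_one hx1 h1, sqrtSum_of_mul_eq_one hK h1]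
    simp [h1]
    ring
  · rw [fiberSum_eq_zero_of_degenerate hx1 ha (by tauto), sqrtSum_of_mul_eq_one hK h1]
    simp [h1, h2]
    ring
  · rw [fiberSum_eq_zero_of_degenerate hx1 ha (by tauto), sqrtSum_comm,
      sqrtSum_of_mul_eq_one hK h2]
    simp [h1, h2]
    ring
  · rw [fiberSum_eq_sqrtSum hK hx1 ha hb (sub_ne_zero.2 (Ne.symm h1))
      (sub_ne_zero.2 (Ne.symm h2))]
    simp [h1, h2]

/-! ### The product formula for character sums -/

/-- Of the three corrections in `fiberSum_eq`, the two supported on a line vanish after summation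
against α or β, leaving the point a = b = x⁻¹. -/
lemma eulerSum_mul_eulerSum_eq (hK : ringChar K ≠ 2) {α β : MulChar K ℂ}
    (hα : α ^ 2 ≠ 1) (hβ : β ^ 2 ≠ 1) {x : K} (hx0 : x ≠ 0) (hx1 : x ≠ 1) :
    eulerSum α β x * eulerSum β α x = cubicSum α β x +
      Fintype.card K * (α * β) x⁻¹ * quadChar K (1 - x⁻¹) := by
  have h1 : 1 - x ≠ 0 := sub_ne_zero.2 (Ne.symm hx1)
  have hxi (a : K) : x * a = 1 ↔ a = x⁻¹ := by rw [mul_comm, mul_eq_one_iff_eq_inv₀ hx0]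
  have hsum {χ : MulChar K ℂ} (hχ : χ ^ 2 ≠ 1) :
      ∑ a : K, χ a * (1 + quadChar K (x * a)) = 0 := by
    have hχ1 : χ ≠ 1 := by rintro rfl; simp at hχ
    have hχφ := mul_quadChar_ne_one hχ
    have e (a : K) : χ a * (1 + quadChar K (x * a)) =
        χ a + quadChar K x * (χ * quadChar K) a := by
      rw [map_mul, MulChar.mul_apply]; ring
    simp only [e]
    rw [sum_add_distrib, ← mul_sum, MulChar.sum_eq_zero_of_ne_one hχ1,
      MulChar.sum_eq_zero_of_ne_one hχφ, mul_zero, add_zero]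
  rw [eulerSum_mul_eulerSum α β hx1, cubicSum_eq_sum_sqrtSum]
  have e (a b : K) : α a * β b * fiberSum x a b = α a * β b * sqrtSum x a b +
      quadChar K (1 - x⁻¹) *
      ((if a = x⁻¹ then (if b = x⁻¹ then α a * β b * (Fintype.card K : ℂ) else 0) else 0) -
      (if b = x⁻¹ then β b * (α a * (1 + quadChar K (x * a))) else 0) -
      (if a = x⁻¹ then α a * (β b * (1 + quadChar K (x * b))) else 0)) := by
    by_cases ha : a = 0
    · subst ha
      simp [MulChar.map_zero]
    by_cases hb : b = 0
    · subst hb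
      simp [MulChar.map_zero]
    rw [fiberSum_eq hK h1 ha hb]
    simp only [hxi]
    split_ifs <;> ring
  simp only [e, sum_add_distrib, ← mul_sum, sum_sub_distrib]
  have s1 : ∑ a : K, ∑ b : K, (if b = x⁻¹ then β b * (α a * (1 + quadChar K (x * a))) else 0) =
      0 := by
    simp only [sum_ite_eq', mem_univ, if_true, ← mul_sum, hsum hα, mul_zero]
  have s2 : ∑ a : K, ∑ b : K, (if a = x⁻¹ then α a * (β b * (1 + quadChar K (x * b))) else 0) =
      0 := by
    rw [sum_comm]
    simp only [sum_ite_eq', mem_univ, if_true, ← mul_sum, hsum hβ, mul_zero]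
  have s3 : ∑ a : K, ∑ b : K,
      (if a = x⁻¹ then (if b = x⁻¹ then α a * β b * (Fintype.card K : ℂ) else 0) else 0) =
      α x⁻¹ * β x⁻¹ * Fintype.card K := by
    rw [sum_comm]
    simp only [sum_ite_eq', mem_univ, if_true]
  rw [s1, s2, s3, MulChar.mul_apply]
  ring

lemma eulerSum_one (α β : MulChar K ℂ) : eulerSum α β 1 = jacobiSum β (quadChar K) := by
  rw [eulerSum, jacobiSum]
  refine sum_congr rfl fun t _ => ?_
  by_cases ht : 1 - t = 0
  · simp [ht, MulChar.map_zero]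
  · rw [one_mul, mul_assoc, ← MulChar.mul_apply, mul_right_comm, mul_inv_cancel, one_mul]

/-- At x = 1 and m² = ab, `fiberForm` factors as (1-a)(1-b), and the root count 1 + φ(ab) splits the
sum into two products. -/
lemma cubicSum_one (hK : ringChar K ≠ 2) (α β : MulChar K ℂ) :
    cubicSum α β 1 = jacobiSum α (quadChar K) * jacobiSum β (quadChar K) +
      jacobiSum (α * quadChar K) (quadChar K) * jacobiSum (β * quadChar K) (quadChar K) := by
  rw [cubicSum_eq_sum_sqrtSum]
  have e (a b : K) : α a * β b * sqrtSum 1 a b =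
      (α a * quadChar K (1 - a)) * (β b * quadChar K (1 - b)) +
      ((α * quadChar K) a * quadChar K (1 - a)) * ((β * quadChar K) b * quadChar K (1 - b)) := by
    have e2 : sqrtSum 1 a b = quadChar K ((1 - a) * (1 - b)) * (1 + quadChar K (a * b)) := by
      rw [← sum_sqrts hK, mul_sum, sqrtSum]
      refine sum_congr rfl fun m _ => ?_
      split_ifs with h
      · rw [mul_one]
        congr 1
        simp only [fiberForm]
        linear_combination h
      · rw [mul_zero]
    rw [e2]
    simp only [map_mul, MulChar.mul_apply]
    ring
  simp only [e, sum_add_distrib, ← sum_mul_sum, jacobiSum]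

/-! ### Clausen's formula -/

lemma clausen_of_ne_one (hK : ringChar K ≠ 2) {ψ : AddChar K ℂ} (hψ : ψ ≠ 1)
    {α β : MulChar K ℂ} (hα : α ^ 2 ≠ 1) (hβ : β ^ 2 ≠ 1) (hαβ : α * β ≠ 1)
    (h : α * β⁻¹ * quadChar K ≠ 1) {x : K} (hx0 : x ≠ 0) (hx1 : x ≠ 1) :
    hypF ψ {α, β} {α * β * quadChar K} x ^ 2 =
      hypF ψ {α ^ 2, β ^ 2, α * β} {α ^ 2 * β ^ 2, α * β * quadChar K} x +
      Fintype.card K * (gCirc ψ (α * β * quadChar K) / (g ψ α * g ψ β)) *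
        (gCirc ψ (α * β * quadChar K) / (g ψ (α * quadChar K) * g ψ (β * quadChar K))) *
        (α * β) x⁻¹ * quadChar K (1 - x⁻¹) := by
  have hF1 := hypF_two_one_eq hψ hα β hx0
  -- The same function, represented with α and β exchanged.
  have hF2 := hypF_two_one_eq hψ hβ α hx0
  rw [mul_comm β α, Multiset.pair_comm β α] at hF2
  rw [sq]
  nth_rewrite 1 [hF1]
  rw [hF2, hypF_three_two_eq hK hψ hα hβ hαβ h hx0]
  have := eulerSum_mul_eulerSum_eq hK hα hβ hx0 hx1
  linear_combination (gCirc ψ (α * β * quadChar K) / (g ψ β * g ψ (α * quadChar K))) *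
    (gCirc ψ (α * β * quadChar K) / (g ψ α * g ψ (β * quadChar K))) * this

/-- The analogue of Gauss's summation formula. -/
lemma hypF_two_one_one (hK : ringChar K ≠ 2) {ψ : AddChar K ℂ} (hψ : ψ ≠ 1)
    {α β : MulChar K ℂ} (hα : α ^ 2 ≠ 1) (hβ : β ^ 2 ≠ 1) :
    hypF ψ {α, β} {α * β * quadChar K} 1 =
      gCirc ψ (α * β * quadChar K) * g ψ (quadChar K) /
        (g ψ (α * quadChar K) * g ψ (β * quadChar K)) := by
  have hβφ := mul_quadChar_ne_one hβ
  rw [hypF_two_one_eq hψ hα β one_ne_zero, eulerSum_one,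
    jacobiSum_eq_g hψ _ _ (Or.inr (quadChar_ne_one hK)), gCirc_of_ne_one ψ hβφ]
  have h1 := g_ne_zero hψ β
  have h2 := g_ne_zero hψ (α * quadChar K)
  have h3 := g_ne_zero hψ (β * quadChar K)
  field_simp

/-- Evaluation of the `₃F₂` at `1`. -/
lemma hypF_three_two_one (hK : ringChar K ≠ 2) {ψ : AddChar K ℂ} (hψ : ψ ≠ 1)
    {α β : MulChar K ℂ} (hα : α ^ 2 ≠ 1) (hβ : β ^ 2 ≠ 1) (hαβ : α * β ≠ 1)
    (h : α * β⁻¹ * quadChar K ≠ 1) :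
    hypF ψ {α ^ 2, β ^ 2, α * β} {α ^ 2 * β ^ 2, α * β * quadChar K} 1 =
      (gCirc ψ (α * β * quadChar K) * g ψ (quadChar K) / (g ψ α * g ψ β)) ^ 2 +
      (gCirc ψ (α * β * quadChar K) * g ψ (quadChar K) /
        (g ψ (α * quadChar K) * g ψ (β * quadChar K))) ^ 2 := by
  have hφ := quadChar_ne_one hK
  have hα1 : α ≠ 1 := by rintro rfl; simp at hα
  have hβ1 : β ≠ 1 := by rintro rfl; simp at hβ
  rw [hypF_three_two_eq hK hψ hα hβ hαβ h one_ne_zero, cubicSum_one hK,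
    jacobiSum_eq_g hψ _ _ (Or.inr hφ), jacobiSum_eq_g hψ _ _ (Or.inr hφ),
    jacobiSum_eq_g hψ _ _ (Or.inr hφ), jacobiSum_eq_g hψ _ _ (Or.inr hφ),
    mul_quadChar_mul_quadChar, mul_quadChar_mul_quadChar,
    gCirc_of_ne_one ψ hα1, gCirc_of_ne_one ψ hβ1, gCirc_of_ne_one ψ (mul_quadChar_ne_one hα),
    gCirc_of_ne_one ψ (mul_quadChar_ne_one hβ)]
  have h1 := g_ne_zero hψ α
  have h2 := g_ne_zero hψ β
  have h3 := g_ne_zero hψ (α * quadChar K)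
  have h4 := g_ne_zero hψ (β * quadChar K)
  field_simp
  ring

lemma hyp_zero (ψ : AddChar K ℂ) (A B : Param K) : hyp ψ A B (0 : K) = 0 := by
  simp [hyp, MulChar.map_zero]

end

end FiniteHypergeometric

open FiniteHypergeometric
theorem theorem6 {K : Type*} [Field K] [Fintype K] (hK : ringChar K ≠ 2)
    (ψ : AddChar K ℂ) (hψ : ψ ≠ 1) (φ : MulChar K ℂ) (hφ : φ = quadChar K)
    (α β : MulChar K ℂ)
    (h₁ : pairing ({α ^ 2} + {β ^ 2} + {α * β}) {1} = 0)
    (h₂ : pairing {α} {β * φ} = 0) :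
    (∀ x : K, x ≠ 0 →
      hypF ψ {α, β} {α * β * φ} x ^ 2
          + (deltaAdd (1 - x) : ℂ) * (gCirc ψ (α * β * φ) * g ψ φ / (g ψ α * g ψ β)) ^ 2
        = hypF ψ {α ^ 2, β ^ 2, α * β} {α ^ 2 * β ^ 2, α * β * φ} x
          + (Fintype.card K : ℂ) * (gCirc ψ (α * β * φ) / (g ψ α * g ψ β))
            * (gCirc ψ (α * β * φ) / (g ψ (α * φ) * g ψ (β * φ)))
            * (α * β) x⁻¹ * φ (1 - x⁻¹)) ∧
    hypF ψ {α ^ 2, β ^ 2, α * β} {α ^ 2 * β ^ 2, α * β * φ} 1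
      = (gCirc ψ (α * β * φ) * g ψ φ / (g ψ α * g ψ β)) ^ 2
        + (gCirc ψ (α * β * φ) * g ψ φ / (g ψ (α * φ) * g ψ (β * φ))) ^ 2 ∧
    (∀ x : K, x ≠ 1 →
      hypF ψ {α, β} {α * β * φ} x ^ 2 = hypF ψ {α * φ, β * φ} {α * β * φ} x ^ 2) := by
  subst hφ
  have hδ {χ : MulChar K ℂ} (h : deltaChar χ = 0) : χ ≠ 1 := by
    rintro rfl
    simp [deltaChar] at h
  simp only [pairing, Multiset.map_add, Multiset.map_singleton, Multiset.sum_add,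
    Multiset.sum_singleton, inv_one, mul_one, add_eq_zero] at h₁ h₂
  obtain ⟨⟨hα, hβ⟩, hαβ⟩ := h₁
  replace hα := hδ hα
  replace hβ := hδ hβ
  replace hαβ := hδ hαβ
  have h : α * β⁻¹ * quadChar K ≠ 1 := by
    have := hδ h₂
    rwa [mul_inv, quadChar_inv, ← mul_assoc] at this
  have hone := hypF_three_two_one hK hψ hα hβ hαβ h
  refine ⟨fun x hx => ?_, hone, fun x hx1 => ?_⟩
  · by_cases hx1 : x = 1
    · subst hx1
      rw [hone, hypF_two_one_one hK hψ hα hβ]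
      -- At x = 1 the last term drops out since φ(0) = 0, and the delta term supplies the other
      -- square.
      simp [deltaAdd, MulChar.map_zero]
      ring
    · rw [clausen_of_ne_one hK hψ hα hβ hαβ h hx hx1]
      simp [deltaAdd, sub_ne_zero.2 (Ne.symm hx1)]
  · by_cases hx : x = 0
    · subst hx
      simp only [hypF, hyp_zero]
    · have hsq (χ : MulChar K ℂ) : (χ * quadChar K) ^ 2 = χ ^ 2 := by
        rw [mul_pow, sq (quadChar K), quadChar_mul_self, mul_one]
      have hmul : α * quadChar K * (β * quadChar K) = α * β := by
        rw [mul_mul_mul_comm, quadChar_mul_self, mul_one]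
      have h' : α * quadChar K * (β * quadChar K)⁻¹ * quadChar K ≠ 1 := by
        rwa [mul_inv, quadChar_inv, mul_mul_mul_comm α, quadChar_mul_self, mul_one]
      -- Twisting by φ fixes α², β² and αβ, and only exchanges the two Gauss sum quotients on the
      -- right.
      have e := clausen_of_ne_one hK hψ (α := α * quadChar K) (β := β * quadChar K)
        (by rwa [hsq]) (by rwa [hsq]) (by rwa [hmul]) h' hx hx1
      rw [hsq, hsq, hmul, mul_quadChar_mul_quadChar, mul_quadChar_mul_quadChar] at e
      rw [e, clausen_of_ne_one hK hψ hα hβ hαβ h hx hx1]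
      ring
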